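/- Consider the four combinatorial triangles $(T(n,k))_{0\le k\le n}$ (with $T(0,0)=1$ and $T(n,k)=0$ unless $0\le k\le n$) that satisfy, for $(n,k)\neq(0,0)$, the recursion $T(n,k)=a(n,k)\,T(n-1,k-1)+b(n,k)\,T(n-1,k)$ with (1) $(a,b)(n,k)=(1,1)$: Pascal's triangle, $T(n,k)=\binom nk$; (2) $(a,b)(n,k)=(1,k)$: Stirling numbers of the second kind; (3) $(a,b)(n,k)=(1,n-1)$: unsigned Stirling numbers of the first kind; (4) $(a,b)(n,k)=(n-k,k+1)$: Eulerian numbers. Set $p_1(m,\ell)=\dfrac{a(m,\ell)\,T(m-1,\ell-1)}{T(m,\ell)}$. Then, in each of the four cases $i=1,2,3,4$, there is a function $\varphi_i:(0,+\infty)\to[0,1]$ such that, for every $\lambda_\infty>0$, when $m,\ell\to+\infty$ with $m/\ell\to 1+\lambda_\infty$, $$p_1(m,\ell)\longrightarrow\varphi_i(\lambda_\infty).$$ Moreover these functions are, for $\lambda>0$: (1) $\varphi_1(\lambda)=\dfrac1{1+\lambda}$; (2) $\varphi_2(\lambda)=e^{-\zeta_2}$, where $\zeta_2=\zeta_2(\lambda)$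 is the unique positive solution (which exists) of $\dfrac{\zeta_2}{1-e^{-\zeta_2}}=1+\lambda$; (3) $\varphi_3(\lambda)=1-\zeta_3$, where $\zeta_3=\zeta_3(\lambda)$ is the unique solution in $(0,1)$ (which exists) of $\dfrac{\zeta_3}{(\zeta_3-1)\ln(1-\zeta_3)}=1+\lambda$; (4) $\varphi_4(\lambda)=1-\dfrac{1}{1+\lambda}\cdot\dfrac{\zeta_4}{e^{\zeta_4}-1}$, where $\zeta_4=\zeta_4(\lambda)$ is the unique real solution (which exists) of $\dfrac1{1+\lambda}=\dfrac{e^{\zeta_4}}{e^{\zeta_4}-1}-\dfrac1{\zeta_4}$; here the functions $\zeta\mapsto\frac{e^\zeta}{e^\zeta-1}-\frac1\zeta$ and $\zeta\mapsto\frac{\zeta}{e^\zeta-1}$ are extended by continuity at $\zeta=0$, by the values $\frac12$ and $1$ respectively. -/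

import Mathlib

namespace PascalTriangles

/-- The Eulerian numbers: `eulerian n k` is the number of permutations of `n` letters with
exactly `k` descents, given by their Pascal formula
`T(n,k) = (n-k) T(n-1,k-1) + (k+1) T(n-1,k)` with `T(0,0) = 1`, and `T = 0` outside
`0 ≤ k ≤ n`. -/
def eulerian : ℕ → ℕ → ℕ
  | 0, 0 => 1
  | 0, _ + 1 => 0
  | n + 1, 0 => eulerian n 0
  | n + 1, k + 1 => (n - k) * eulerian n k + (k + 2) * eulerian n (k + 1)

/-- The transition probability `p₁(n,k) = a(n,k) T(n-1,k-1) / T(n,k)` of a triangle with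
Pascal formula `T(n,k) = a(n,k) T(n-1,k-1) + b(n,k) T(n-1,k)`
(where `T(n-1,k-1) = 0` if `k = 0`). -/
noncomputable def p₁ (a : ℕ → ℕ → ℝ) (T : ℕ → ℕ → ℕ) : ℕ → ℕ → ℝ
  | n + 1, k + 1 => a (n + 1) (k + 1) * (T n k : ℝ) / (T (n + 1) (k + 1) : ℝ)
  | _, _ => 0

/-- `φ` is the limit slope of the triangle: for every `r > 0`, when `m, ℓ → ∞` with
`m / ℓ → 1 + r`, one has `p₁(m,ℓ) → φ(r)`. -/
def IsLimitSlope (a : ℕ → ℕ → ℝ) (T : ℕ → ℕ → ℕ)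
    (φ : Set.Ioi (0 : ℝ) → Set.Icc (0 : ℝ) 1) : Prop :=
  ∀ (r : Set.Ioi (0 : ℝ)) (m l : ℕ → ℕ),
    Filter.Tendsto m Filter.atTop Filter.atTop →
    Filter.Tendsto l Filter.atTop Filter.atTop →
    Filter.Tendsto (fun i => (m i : ℝ) / (l i : ℝ)) Filter.atTop (nhds (1 + (r : ℝ))) →
    Filter.Tendsto (fun i => p₁ a T (m i) (l i)) Filter.atTop (nhds ((φ r : ℝ)))

/-- The saddle-point equation for Stirling numbers of the second kind; `z > 0`. -/
def SaddleSecond (r z : ℝ) : Prop :=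
  0 < z ∧ z / (1 - Real.exp (-z)) = 1 + r

/-- The saddle-point equation for Stirling numbers of the first kind; `z ∈ (0,1)`. -/
def SaddleFirst (r z : ℝ) : Prop :=
  z ∈ Set.Ioo (0 : ℝ) 1 ∧ z / ((z - 1) * Real.log (1 - z)) = 1 + r

/-- `z ↦ e^z / (e^z - 1) - 1 / z`, extended by continuity at `0`; it is the derivative of
`log ((e^z - 1) / z)`, the cumulant generating function of the uniform law on `[0,1]`. -/
noncomputable def uniformTilt (z : ℝ) : ℝ :=
  if z = 0 then 1 / 2 else Real.exp z / (Real.exp z - 1) - 1 / z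

/-- `z ↦ z / (e^z - 1)`, extended by continuity at `0`. -/
noncomputable def bernoulliQuotient (z : ℝ) : ℝ :=
  if z = 0 then 1 else z / (Real.exp z - 1)

/-- The equation for the Eulerian numbers; `z ∈ ℝ`. -/
def SaddleEuler (r z : ℝ) : Prop :=
  1 / (1 + r) = uniformTilt z

end PascalTriangles

/-! Dividing numerator and denominator of `p₁` by `T(n,k)` shows that, for the Stirling numbers of
the first kind and the Eulerian numbers, it depends only on the weights and on `T(n,k+1) / T(n,k)`,
where `n = m - 1`, `k = ℓ - 1`. For the second kind it is `1 - ℓ S(m-1,ℓ) / S(m,ℓ)`, a ratio along a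
column. For binomials `p₁ = ℓ / m` exactly.

The other three cases rest on `tendsto_ratio`, which replaces a local saddle-point expansion by
log-concavity. Suppose generating functions `P y` grow like `exp (L Λ(y))`, up to a factor
independent of `y`. If a coefficient ratio at position `l ≈ lam L` stayed on the wrong side of
`x₀⁻¹`, log-concavity would bound `P y` by a constant times `P y' * (y / y') ^ l` for some `y, y'`
on one side of `x₀`, with `y'` nearer `x₀`. Then `Λ - lam log` would not decrease from `y` to `y'`,
although it is strictly monotone towards a minimum at `x₀`.

The inputs are log-concavity (`LogConcaveSeq.step`, `stirlingSecond_minor_nonneg`,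
`eulerian_step_aux`) and growth rates. The latter come from `(e^z - 1)^l / l!` for the second kind,
the rising factorial for the first, and Worpitzky's identity with a Gamma integral for the Eulerian
numbers. Convexity of `exp` and monotonicity of `uniformTilt` make the saddle points unique. -/

namespace PascalTriangles

open Filter Topology

/-! ### Log-concavity and the ratio limit theorem -/

/-- The ratios `a (k + 1) / a k` of the nonnegative sequence `a` are nonincreasing. -/
structure LogConcaveSeq (a : ℕ → ℝ) : Prop where
  nonneg : ∀ k, 0 ≤ a k
  mul_le : ∀ j k, j ≤ k → a j * a (k + 1) ≤ a (j + 1) * a k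

namespace LogConcaveSeq

variable {a : ℕ → ℝ} {l : ℕ} {x : ℝ}

theorem le_pow_mul_of_le (ha : LogConcaveSeq a) (hl : 0 < a (l + 1)) (hx : 0 < x)
    (h : a l ≤ x * a (l + 1)) (j : ℕ) (hj : j ≤ l) : a (l - j) ≤ x ^ j * a l := by
  induction j with
  | zero => simp
  | succ j ih =>
    have h1 := ha.mul_le (l - (j + 1)) l (Nat.sub_le _ _)
    rw [show l - (j + 1) + 1 = l - j by omega] at h1
    have h2 : a (l - (j + 1)) * a (l + 1) ≤ (x * a (l - j)) * a (l + 1) := by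
      nlinarith [mul_le_mul_of_nonneg_left h (ha.nonneg (l - j))]
    have h3 := le_of_mul_le_mul_right h2 hl
    calc a (l - (j + 1)) ≤ x * a (l - j) := h3
      _ ≤ x * (x ^ j * a l) := by gcongr; exact ih (by omega)
      _ = x ^ (j + 1) * a l := by ring

theorem pow_mul_le_of_le (ha : LogConcaveSeq a) (hl : 0 < a l) (hx : 0 < x)
    (h : x * a (l + 1) ≤ a l) (j : ℕ) : x ^ j * a (l + j) ≤ a l := by
  induction j with
  | zero => simp
  | succ j ih =>
    have h1 := ha.mul_le l (l + j) (Nat.le_add_right _ _)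
    have h2 : (x * a (l + j + 1)) * a l ≤ a (l + j) * a l := by
      nlinarith [mul_le_mul_of_nonneg_right h (ha.nonneg (l + j))]
    have h3 := le_of_mul_le_mul_right h2 hl
    calc x ^ (j + 1) * a (l + (j + 1)) = x ^ j * (x * a (l + j + 1)) := by
          rw [← add_assoc]; ring
      _ ≤ x ^ j * a (l + j) := by gcongr
      _ ≤ a l := ih

theorem term_le {y p : ℝ} (ha : LogConcaveSeq a) (hy : 0 < y)
    (hp : HasSum (fun k => a k * y ^ k) p) (k : ℕ) : a k * y ^ k ≤ p :=
  le_hasSum hp k fun j _ => mul_nonneg (ha.nonneg j) (by positivity)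

/-- Up to index `l`, the terms at `y` are dominated by a geometric series of ratio `x / y`
descending from `a l * y ^ l`, which is at most `p' * (y / y') ^ l`. Beyond `l`, passing from `y'`
to `y` gains at least `(y / y') ^ l` in each term; this tail accounts for the `+ 1`. -/
theorem sum_le_of_le {y y' p p' : ℝ} (ha : LogConcaveSeq a) (hl : 0 < a (l + 1)) (hx : 0 < x)
    (hxy : x < y) (hyy : y < y') (h : a l ≤ x * a (l + 1))
    (hp : HasSum (fun k => a k * y ^ k) p) (hp' : HasSum (fun k => a k * y' ^ k) p') :
    p ≤ ((1 - x / y)⁻¹ + 1) * (p' * (y / y') ^ l) := by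
  have hy : 0 < y := hx.trans hxy
  have hy' : 0 < y' := hy.trans hyy
  have hr1 : x / y < 1 := (div_lt_one hy).2 hxy
  have hr0 : 0 ≤ x / y := by positivity
  have hq1 : y / y' ≤ 1 := ((div_lt_one hy').2 hyy).le
  have hsplit : ∀ k, a k * y ^ k = a k * y' ^ k * (y / y') ^ k := by
    intro k; rw [div_pow]; field_simp
  have hal : a l * y ^ l ≤ p' * (y / y') ^ l := by
    rw [hsplit]; gcongr; exact ha.term_le hy' hp' l
  have h1 : ∑ k ∈ Finset.range (l + 1), a k * y ^ k ≤ (1 - x / y)⁻¹ * (a l * y ^ l) := by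
    rw [← Finset.sum_range_reflect]
    calc ∑ j ∈ Finset.range (l + 1), a (l + 1 - 1 - j) * y ^ (l + 1 - 1 - j)
        ≤ ∑ j ∈ Finset.range (l + 1), (x / y) ^ j * (a l * y ^ l) := by
          refine Finset.sum_le_sum fun j hj => ?_
          have hj' : j ≤ l := Nat.lt_succ_iff.1 (Finset.mem_range.1 hj)
          have e : y ^ l = y ^ (l - j) * y ^ j := by rw [← pow_add]; congr 1; omega
          have := ha.le_pow_mul_of_le hl hx h j hj'
          calc a (l + 1 - 1 - j) * y ^ (l + 1 - 1 - j) ≤ (x ^ j * a l) * y ^ (l - j) := by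
                simp only [Nat.add_sub_cancel]; gcongr
            _ = (x / y) ^ j * (a l * y ^ l) := by rw [e, div_pow]; field_simp
      _ = (∑ j ∈ Finset.range (l + 1), (x / y) ^ j) * (a l * y ^ l) := by rw [Finset.sum_mul]
      _ ≤ (1 - x / y)⁻¹ * (a l * y ^ l) := by
          refine mul_le_mul_of_nonneg_right ?_ (mul_nonneg (ha.nonneg l) (by positivity))
          exact sum_le_hasSum _ (fun j _ => by positivity) (hasSum_geometric_of_lt_one hr0 hr1)
  have h2 : ∑' j, a (j + (l + 1)) * y ^ (j + (l + 1)) ≤ p' * (y / y') ^ l := by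
    have hs := (summable_nat_add_iff (f := fun k => a k * y ^ k) (l + 1)).2 hp.summable
    have hs' := (summable_nat_add_iff (f := fun k => a k * y' ^ k) (l + 1)).2 hp'.summable
    calc _ ≤ ∑' j, a (j + (l + 1)) * y' ^ (j + (l + 1)) * (y / y') ^ l := by
          refine hs.tsum_le_tsum (fun j => ?_) (hs'.mul_right _)
          rw [hsplit]
          refine mul_le_mul_of_nonneg_left (pow_le_pow_of_le_one (by positivity) hq1 (by omega))
            (mul_nonneg (ha.nonneg _) (by positivity))
      _ = (∑' j, a (j + (l + 1)) * y' ^ (j + (l + 1))) * (y / y') ^ l := tsum_mul_right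
      _ ≤ p' * (y / y') ^ l := by
          gcongr
          have := hp'.summable.sum_add_tsum_nat_add (l + 1)
          rw [hp'.tsum_eq] at this
          have h0 : 0 ≤ ∑ k ∈ Finset.range (l + 1), a k * y' ^ k :=
            Finset.sum_nonneg fun k _ => mul_nonneg (ha.nonneg k) (by positivity)
          linarith
  have h3 := hp.summable.sum_add_tsum_nat_add (l + 1)
  rw [hp.tsum_eq] at h3
  have h4 : (1 - x / y)⁻¹ * (a l * y ^ l) ≤ (1 - x / y)⁻¹ * (p' * (y / y') ^ l) :=
    mul_le_mul_of_nonneg_left hal (inv_nonneg.2 (by linarith))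
  linarith

theorem sum_le_of_ge {y y' p p' : ℝ} (ha : LogConcaveSeq a) (hl : 0 < a l) (hy' : 0 < y')
    (hyy : y' < y) (hxy : y < x) (h : x * a (l + 1) ≤ a l)
    (hp : HasSum (fun k => a k * y ^ k) p) (hp' : HasSum (fun k => a k * y' ^ k) p') :
    p ≤ ((1 - y / x)⁻¹ + 1) * (p' * (y / y') ^ l) := by
  have hy : 0 < y := hy'.trans hyy
  have hx : 0 < x := hy.trans hxy
  have hr1 : y / x < 1 := (div_lt_one hx).2 hxy
  have hr0 : 0 ≤ y / x := by positivity
  have hq1 : 1 ≤ y / y' := ((one_lt_div hy').2 hyy).le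
  have hsplit : ∀ k, a k * y ^ k = a k * y' ^ k * (y / y') ^ k := by
    intro k; rw [div_pow]; field_simp
  have hal : a l * y ^ l ≤ p' * (y / y') ^ l := by
    rw [hsplit]; gcongr; exact ha.term_le hy' hp' l
  have h1 : ∑ k ∈ Finset.range l, a k * y ^ k ≤ p' * (y / y') ^ l := by
    calc ∑ k ∈ Finset.range l, a k * y ^ k
        ≤ ∑ k ∈ Finset.range l, a k * y' ^ k * (y / y') ^ l := by
          refine Finset.sum_le_sum fun k hk => ?_
          rw [hsplit]
          exact mul_le_mul_of_nonneg_left (pow_le_pow_right₀ hq1 (Finset.mem_range.1 hk).le)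
            (mul_nonneg (ha.nonneg _) (by positivity))
      _ = (∑ k ∈ Finset.range l, a k * y' ^ k) * (y / y') ^ l := by rw [Finset.sum_mul]
      _ ≤ p' * (y / y') ^ l := by
          gcongr
          exact sum_le_hasSum _ (fun k _ => mul_nonneg (ha.nonneg k) (by positivity)) hp'
  have hgeo := (hasSum_geometric_of_lt_one hr0 hr1).mul_right (a l * y ^ l)
  have h2 : ∑' j, a (j + l) * y ^ (j + l) ≤ (1 - y / x)⁻¹ * (a l * y ^ l) := by
    have hs := (summable_nat_add_iff (f := fun k => a k * y ^ k) l).2 hp.summable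
    rw [← hgeo.tsum_eq]
    refine hs.tsum_le_tsum (fun j => ?_) hgeo.summable
    have h5 := ha.pow_mul_le_of_le hl hx h j
    calc a (j + l) * y ^ (j + l) = (y / x) ^ j * (x ^ j * a (l + j) * y ^ l) := by
          rw [add_comm j l, div_pow, pow_add]; field_simp
      _ ≤ (y / x) ^ j * (a l * y ^ l) := by gcongr
  have h3 := hp.summable.sum_add_tsum_nat_add l
  rw [hp.tsum_eq] at h3
  have h4 : (1 - y / x)⁻¹ * (a l * y ^ l) ≤ (1 - y / x)⁻¹ * (p' * (y / y') ^ l) :=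
    mul_le_mul_of_nonneg_left hal (inv_nonneg.2 (by linarith))
  linarith

end LogConcaveSeq

/-- If `P y ≤ C * P y' * (y / y') ^ l` for infinitely many members of a family, then the
exponential growth rates of the `P y` satisfy the corresponding inequality. -/
theorem growth_le_of_frequently {l : ℕ → ℕ} {L c p p' : ℕ → ℝ} {C y y' lam A A' : ℝ}
    (hy : 0 < y) (hy' : 0 < y') (hC : 0 < C)
    (hL : Tendsto L atTop atTop) (hl : Tendsto (fun i => (l i : ℝ) / L i) atTop (𝓝 lam))
    (hA : Tendsto (fun i => (Real.log (p i) - c i) / L i) atTop (𝓝 A))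
    (hA' : Tendsto (fun i => (Real.log (p' i) - c i) / L i) atTop (𝓝 A'))
    (h : ∃ᶠ i in atTop, 0 < p i ∧ 0 < p' i ∧ p i ≤ C * (p' i * (y / y') ^ l i)) :
    A - lam * Real.log y ≤ A' - lam * Real.log y' := by
  have h1 : Tendsto (fun i => Real.log C / L i + (Real.log (p' i) - c i) / L i
      + (l i : ℝ) / L i * Real.log (y / y')) atTop (𝓝 (0 + A' + lam * Real.log (y / y'))) :=
    ((hL.const_div_atTop _).add hA').add (hl.mul_const _)
  -- Since both limits exist, the inequality is needed only for infinitely many `i`; the constant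
  -- contributes `log C / L → 0`.
  have h2 : A ≤ 0 + A' + lam * Real.log (y / y') := by
    refine le_of_tendsto_of_tendsto_of_frequently hA h1 ?_
    refine (h.and_eventually (hL.eventually_gt_atTop 0)).mono ?_
    rintro i ⟨⟨h0, h0', hi⟩, hLi⟩
    have hq : 0 < y / y' := by positivity
    have := Real.log_le_log h0 hi
    rw [Real.log_mul hC.ne' (by positivity), Real.log_mul h0'.ne' (by positivity),
      Real.log_pow] at this
    rw [← add_div, div_mul_eq_mul_div, ← add_div]
    gcongr
    linarith
  rw [Real.log_div hy.ne' hy'.ne'] at h2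
  linarith

/-- **Ratio limit theorem.**  For log-concave sequences whose generating functions `P` have an
exponential growth rate `Λ` near `x₀`, the ratio of consecutive coefficients in position `l`
converges to `x₀⁻¹`, where `x₀` solves the saddle-point equation `x₀ Λ'(x₀) = lam = lim l / L`. -/
theorem tendsto_ratio {a : ℕ → ℕ → ℝ} {P : ℕ → ℝ → ℝ} {l : ℕ → ℕ} {L c : ℕ → ℝ}
    {Λ h : ℝ → ℝ} {x₀ lam : ℝ} (hx₀ : 0 < x₀) (ha : ∀ i, LogConcaveSeq (a i))
    (hP : ∀ i y, 0 < y → HasSum (fun k => a i k * y ^ k) (P i y))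
    (hpos : ∀ᶠ i in atTop, 0 < a i (l i))
    (hL : Tendsto L atTop atTop) (hl : Tendsto (fun i => (l i : ℝ) / L i) atTop (𝓝 lam))
    (hΛ : ∀ᶠ y in 𝓝[≠] x₀, HasDerivAt Λ (h y / y) y ∧
      Tendsto (fun i => (Real.log (P i y) - c i) / L i) atTop (𝓝 (Λ y)))
    (hlt : ∀ y, 0 < y → y < x₀ → h y < lam) (hgt : ∀ y, x₀ < y → lam < h y) :
    Tendsto (fun i => a i (l i + 1) / a i (l i)) atTop (𝓝 x₀⁻¹) := by
  have hder : ∀ y, 0 < y → HasDerivAt Λ (h y / y) y →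
      HasDerivAt (fun t => Λ t - lam * Real.log t) ((h y - lam) / y) y := by
    intro y hy hd
    refine (hd.sub ((Real.hasDerivAt_log hy.ne').const_mul lam)).congr_deriv ?_
    field_simp
  have hPpos : ∀ᶠ i in atTop, ∀ y, 0 < y → 0 < P i y := by
    filter_upwards [hpos] with i hi y hy
    exact lt_of_lt_of_le (by positivity) ((ha i).term_le hy (hP i y hy) (l i))
  rw [eventually_nhdsWithin_iff, Metric.eventually_nhds_iff] at hΛ
  obtain ⟨ε, hε, hΛ⟩ := hΛ
  -- Both `y` and `y'` lie strictly between `x` and `x₀`, so only the punctured neighbourhood of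
  -- `x₀` is used.
  have hup : ∀ x, 0 < x → x < x₀ → ∀ᶠ i in atTop, x * a i (l i + 1) < a i (l i) := by
    intro x hx hxx
    obtain ⟨y, hy1, hy2⟩ := exists_between (max_lt hxx (sub_lt_self x₀ hε))
    obtain ⟨y', hyy, hy2'⟩ := exists_between hy2
    obtain ⟨hxy, hεy⟩ := max_lt_iff.1 hy1
    have hy : 0 < y := hx.trans hxy
    have hmem : ∀ t ∈ Set.Icc y y', HasDerivAt Λ (h t / t) t ∧
        Tendsto (fun i => (Real.log (P i t) - c i) / L i) atTop (𝓝 (Λ t)) := by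
      intro t ht
      refine hΛ ?_ (ne_of_lt (ht.2.trans_lt hy2'))
      rw [Real.dist_eq, abs_lt]
      constructor <;> linarith [ht.1, ht.2]
    by_contra hcon
    rw [not_eventually] at hcon
    have key : Λ y - lam * Real.log y ≤ Λ y' - lam * Real.log y' := by
      refine growth_le_of_frequently (C := (1 - x / y)⁻¹ + 1) hy (hy.trans hyy) ?_ hL hl
        (hmem y ⟨le_rfl, hyy.le⟩).2 (hmem y' ⟨hyy.le, le_rfl⟩).2 ?_
      · have : 0 < 1 - x / y := by rw [sub_pos]; exact (div_lt_one hy).2 hxy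
        positivity
      · refine (hcon.and_eventually (hPpos.and hpos)).mono ?_
        rintro i ⟨hi, hi1, hi2⟩
        rw [not_lt] at hi
        refine ⟨hi1 y hy, hi1 y' (hy.trans hyy), (ha i).sum_le_of_le ?_ hx hxy hyy hi
          (hP i y hy) (hP i y' (hy.trans hyy))⟩
        exact pos_of_mul_pos_right (hi2.trans_le hi) hx.le
    have hanti : StrictAntiOn (fun t => Λ t - lam * Real.log t) (Set.Icc y y') := by
      refine strictAntiOn_of_deriv_neg (convex_Icc y y') (fun t ht => ?_) (fun t ht => ?_)
      · exact (hder t (hy.trans_le ht.1) (hmem t ht).1).continuousAt.continuousWithinAt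
      · have ht := interior_subset ht
        rw [(hder t (hy.trans_le ht.1) (hmem t ht).1).deriv]
        exact div_neg_of_neg_of_pos
          (sub_neg.2 (hlt t (hy.trans_le ht.1) (ht.2.trans_lt hy2'))) (hy.trans_le ht.1)
    exact absurd key (not_le.2 (hanti ⟨le_rfl, hyy.le⟩ ⟨hyy.le, le_rfl⟩ hyy))
  have hlow : ∀ x, x₀ < x → ∀ᶠ i in atTop, a i (l i) < x * a i (l i + 1) := by
    intro x hxx
    obtain ⟨y, hy1, hy2⟩ := exists_between (lt_min hxx (lt_add_of_pos_right x₀ hε))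
    obtain ⟨y', hy1', hyy⟩ := exists_between hy1
    obtain ⟨hxy, hεy⟩ := lt_min_iff.1 hy2
    have hy' : 0 < y' := hx₀.trans hy1'
    have hmem : ∀ t ∈ Set.Icc y' y, HasDerivAt Λ (h t / t) t ∧
        Tendsto (fun i => (Real.log (P i t) - c i) / L i) atTop (𝓝 (Λ t)) := by
      intro t ht
      refine hΛ ?_ (ne_of_gt (hy1'.trans_le ht.1))
      rw [Real.dist_eq, abs_lt]
      constructor <;> linarith [ht.1, ht.2]
    by_contra hcon
    rw [not_eventually] at hcon
    have key : Λ y - lam * Real.log y ≤ Λ y' - lam * Real.log y' := by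
      refine growth_le_of_frequently (C := (1 - y / x)⁻¹ + 1) (hy'.trans hyy) hy' ?_ hL hl
        (hmem y ⟨hyy.le, le_rfl⟩).2 (hmem y' ⟨le_rfl, hyy.le⟩).2 ?_
      · have : 0 < 1 - y / x := by
          rw [sub_pos]; exact (div_lt_one ((hy'.trans hyy).trans hxy)).2 hxy
        positivity
      · refine (hcon.and_eventually (hPpos.and hpos)).mono ?_
        rintro i ⟨hi, hi1, hi2⟩
        rw [not_lt] at hi
        exact ⟨hi1 y (hy'.trans hyy), hi1 y' hy', (ha i).sum_le_of_ge hi2 hy' hyy hxy hi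
          (hP i y (hy'.trans hyy)) (hP i y' hy')⟩
    have hmono : StrictMonoOn (fun t => Λ t - lam * Real.log t) (Set.Icc y' y) := by
      refine strictMonoOn_of_deriv_pos (convex_Icc y' y) (fun t ht => ?_) (fun t ht => ?_)
      · exact (hder t (hy'.trans_le ht.1) (hmem t ht).1).continuousAt.continuousWithinAt
      · have ht := interior_subset ht
        rw [(hder t (hy'.trans_le ht.1) (hmem t ht).1).deriv]
        exact div_pos (sub_pos.2 (hgt t (hy1'.trans_le ht.1))) (hy'.trans_le ht.1)
    exact absurd key (not_le.2 (hmono ⟨le_rfl, hyy.le⟩ ⟨hyy.le, le_rfl⟩ hyy))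
  rw [tendsto_order]
  constructor
  · intro b hb
    obtain ⟨b', hb1, hb2⟩ := exists_between (max_lt hb (inv_pos.2 hx₀))
    obtain ⟨hbb, hb0⟩ := max_lt_iff.1 hb1
    filter_upwards [hlow b'⁻¹ ((lt_inv_comm₀ hb0 hx₀).1 hb2), hpos] with i hi hi0
    refine hbb.trans ?_
    rw [lt_div_iff₀ hi0]
    rwa [inv_mul_eq_div, lt_div_iff₀ hb0, mul_comm] at hi
  · intro b hb
    have hb0 : 0 < b := (inv_pos.2 hx₀).trans hb
    filter_upwards [hup b⁻¹ (inv_pos.2 hb0) ((inv_lt_comm₀ hx₀ hb0).1 hb), hpos] with i hi hi0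
    rw [div_lt_iff₀ hi0]
    rwa [inv_mul_eq_div, div_lt_iff₀ hb0, mul_comm] at hi

/-! ### Log-concavity of the triangles -/

namespace LogConcaveSeq

theorem mul {a b : ℕ → ℝ} (ha : LogConcaveSeq a) (hb : LogConcaveSeq b) :
    LogConcaveSeq fun k => a k * b k where
  nonneg k := mul_nonneg (ha.nonneg k) (hb.nonneg k)
  mul_le j k hjk := by
    calc a j * b j * (a (k + 1) * b (k + 1)) = (a j * a (k + 1)) * (b j * b (k + 1)) := by ring
      _ ≤ (a (j + 1) * a k) * (b (j + 1) * b k) :=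
          mul_le_mul (ha.mul_le j k hjk) (hb.mul_le j k hjk)
            (mul_nonneg (hb.nonneg _) (hb.nonneg _)) (mul_nonneg (ha.nonneg _) (ha.nonneg _))
      _ = _ := by ring

theorem pow {t : ℝ} (ht : 0 ≤ t) : LogConcaveSeq fun k => t ^ k where
  nonneg k := by positivity
  mul_le j k _ := by rw [← pow_add, ← pow_add]; exact le_of_eq (by congr 1; omega)

theorem inv_factorial : LogConcaveSeq fun k => ((k.factorial : ℝ))⁻¹ where
  nonneg k := by positivity
  mul_le j k hjk := by
    rw [← mul_inv, ← mul_inv]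
    refine inv_anti₀ (by positivity) ?_
    rw [Nat.factorial_succ, Nat.factorial_succ]
    push_cast
    have : (j : ℝ) ≤ k := by exact_mod_cast hjk
    have h : (0 : ℝ) ≤ (j.factorial : ℝ) * k.factorial := by positivity
    nlinarith

theorem single : LogConcaveSeq fun k => if k = 0 then (1 : ℝ) else 0 where
  nonneg k := by split_ifs <;> norm_num
  mul_le j k _ := by simp

/-- Log-concavity is preserved by `b (k + 1) = (p k + q) a (k + 1) + a k`, `b 0 = 0`. -/
theorem step {a b : ℕ → ℝ} {p q : ℝ} (ha : LogConcaveSeq a) (hp : 0 ≤ p) (hq : 0 ≤ q)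
    (h0 : b 0 = 0) (hb : ∀ k : ℕ, b (k + 1) = (p * k + q) * a (k + 1) + a k) :
    LogConcaveSeq b where
  nonneg k := by
    cases k with
    | zero => rw [h0]
    | succ k =>
      rw [hb]
      exact add_nonneg (mul_nonneg (by positivity) (ha.nonneg _)) (ha.nonneg _)
  mul_le j k hjk := by
    have hbn : ∀ k, 0 ≤ b (k + 1) := fun k => by
      rw [hb]
      exact add_nonneg (mul_nonneg (by positivity) (ha.nonneg _)) (ha.nonneg _)
    rcases hjk.eq_or_lt with rfl | hlt
    · rw [mul_comm]
    obtain ⟨k, rfl⟩ : ∃ k', k = k' + 1 := ⟨k - 1, by omega⟩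
    cases j with
    | zero =>
      rw [h0, zero_mul]
      exact mul_nonneg (hbn _) (hbn _)
    | succ j =>
      rw [hb, hb, hb, hb]
      have hjk' : (j : ℝ) ≤ k := by exact_mod_cast (by omega : j ≤ k)
      have hj0 : (0 : ℝ) ≤ j := by positivity
      push_cast
      have F1 := ha.mul_le (j + 1) (k + 1) (by omega)
      have F2 := ha.mul_le j k (by omega)
      have F3 := ha.mul_le j (k + 1) (by omega)
      have F4 := ha.mul_le (j + 1) k (by omega)
      have N1 := mul_nonneg (ha.nonneg (j + 1 + 1)) (ha.nonneg (k + 1))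
      have c1 : 0 ≤ p * (k + 1) + q := by positivity
      have c2 : 0 ≤ (p * j + q) * (p * (k + 1) + q) := by positivity
      have c3 : 0 ≤ p * (j + 1) + q := by positivity
      -- This is `(p(j+1)+q)(pk+q) - (pj+q)(p(k+1)+q)`, the surplus left after `F1`; the
      -- coefficients of `a (j+1) * a (k+1)` balance exactly after `F3` and `F4`.
      have c4 : 0 ≤ p * p * (k - j) := mul_nonneg (mul_nonneg hp hp) (by linarith)
      have G1 := mul_le_mul_of_nonneg_left F1 c2
      have G3 := mul_le_mul_of_nonneg_left F3 c1
      have G4 := mul_le_mul_of_nonneg_left F4 c3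
      have G5 := mul_nonneg c4 N1
      linarith

end LogConcaveSeq

theorem logConcaveSeq_stirlingFirst (n : ℕ) :
    LogConcaveSeq fun k => (Nat.stirlingFirst n k : ℝ) := by
  induction n with
  | zero =>
    convert LogConcaveSeq.single using 2 with k
    cases k <;> simp
  | succ n ih =>
    refine ih.step (p := 0) (q := n) le_rfl (by positivity) (by simp) fun k => ?_
    rw [Nat.stirlingFirst_succ_succ]
    push_cast
    ring

theorem logConcaveSeq_stirlingSecond (n : ℕ) :
    LogConcaveSeq fun k => (Nat.stirlingSecond n k : ℝ) := by
  induction n with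
  | zero =>
    convert LogConcaveSeq.single using 2 with k
    cases k <;> simp
  | succ n ih =>
    refine ih.step (p := 1) (q := 1) zero_le_one zero_le_one (by simp) fun k => ?_
    rw [Nat.stirlingSecond_succ_succ]
    push_cast
    ring

theorem stirlingFirst_pos (n k : ℕ) (h : k ≤ n) : 0 < Nat.stirlingFirst (n + 1) (k + 1) := by
  induction n generalizing k with
  | zero =>
    obtain rfl : k = 0 := by omega
    decide
  | succ n ih =>
    rw [Nat.stirlingFirst_succ_succ]
    rcases h.eq_or_lt with rfl | h
    · rw [Nat.stirlingFirst_self]; omega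
    · have := ih k (by omega)
      positivity

theorem stirlingSecond_pos (n k : ℕ) (h : k ≤ n) : 0 < Nat.stirlingSecond (n + 1) (k + 1) := by
  induction n generalizing k with
  | zero =>
    obtain rfl : k = 0 := by omega
    decide
  | succ n ih =>
    rw [Nat.stirlingSecond_succ_succ]
    rcases h.eq_or_lt with rfl | h
    · rw [Nat.stirlingSecond_self]; omega
    · have := ih k (by omega)
      positivity

/-- Total positivity of order two for adjacent columns, by induction on the row gap `d`. Expanding
the lower row by the recurrence produces the same minor one row up and a mixed one; the latter
follows from the former and log-concavity of row `j + d`, after cancelling a positive entry. -/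
theorem stirlingSecond_minor_nonneg (j l d : ℕ) :
    (Nat.stirlingSecond j (l + 1) : ℝ) * Nat.stirlingSecond (j + d) l ≤
      Nat.stirlingSecond j l * Nat.stirlingSecond (j + d) (l + 1) := by
  induction d generalizing l with
  | zero => rw [add_zero, mul_comm]
  | succ d ih =>
    rw [← add_assoc]
    cases l with
    | zero => rw [Nat.stirlingSecond_succ_zero]; push_cast; rw [mul_zero]; positivity
    | succ l =>
      have h1 := ih (l + 1)
      have h2 : (Nat.stirlingSecond j (l + 2) : ℝ) * Nat.stirlingSecond (j + d) l ≤
          Nat.stirlingSecond j (l + 1) * Nat.stirlingSecond (j + d) (l + 1) := by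
        rcases Nat.lt_or_ge (j + d) (l + 1) with hlt | hge
        · rw [Nat.stirlingSecond_eq_zero_of_lt (n := j) (by omega)]
          push_cast
          rw [zero_mul]
          positivity
        · have hpos : (0 : ℝ) < Nat.stirlingSecond (j + d) (l + 1) := by
            have := stirlingSecond_pos (j + d - 1) l (by omega)
            rw [Nat.sub_add_cancel (by omega)] at this
            exact_mod_cast this
          have h3 := (logConcaveSeq_stirlingSecond (j + d)).mul_le l (l + 1) (by omega)
          refine le_of_mul_le_mul_right ?_ hpos
          have h4 := mul_le_mul_of_nonneg_right h1
            (Nat.cast_nonneg (α := ℝ) (Nat.stirlingSecond (j + d) l))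
          have h5 := mul_le_mul_of_nonneg_left h3
            (Nat.cast_nonneg (α := ℝ) (Nat.stirlingSecond j (l + 1)))
          linarith
      rw [Nat.stirlingSecond_succ_succ, Nat.stirlingSecond_succ_succ]
      push_cast
      have h6 := mul_le_mul_of_nonneg_left h1 (by positivity : (0 : ℝ) ≤ (l : ℝ) + 1)
      have h7 : (0 : ℝ) ≤ (Nat.stirlingSecond j (l + 1) : ℝ) *
        Nat.stirlingSecond (j + d) (l + 2) := by positivity
      linarith

/-- After one use of the recurrence in each product, the terms in `S(j,l+1) S(k,l+1)` cancel and the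
minor inequality remains. -/
theorem logConcaveSeq_stirlingSecond_left (l : ℕ) :
    LogConcaveSeq fun m => (Nat.stirlingSecond m l : ℝ) where
  nonneg k := Nat.cast_nonneg _
  mul_le j k hjk := by
    obtain ⟨d, rfl⟩ := Nat.exists_eq_add_of_le hjk
    cases l with
    | zero => simp
    | succ l =>
      have := stirlingSecond_minor_nonneg j l d
      rw [Nat.stirlingSecond_succ_succ, Nat.stirlingSecond_succ_succ]
      push_cast
      linarith

theorem eulerian_succ_succ (n k : ℕ) :
    eulerian (n + 1) (k + 1) = (n - k) * eulerian n k + (k + 2) * eulerian n (k + 1) := by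
  rw [eulerian]

theorem eulerian_succ_zero (n : ℕ) : eulerian (n + 1) 0 = eulerian n 0 := by
  rw [eulerian]

theorem eulerian_eq_zero_of_lt (n k : ℕ) (h : n < k) : eulerian n k = 0 := by
  induction n generalizing k with
  | zero =>
    obtain ⟨k, rfl⟩ : ∃ k', k = k' + 1 := ⟨k - 1, by omega⟩
    rw [eulerian]
  | succ n ih =>
    obtain ⟨k, rfl⟩ : ∃ k', k = k' + 1 := ⟨k - 1, by omega⟩
    rw [eulerian_succ_succ, ih k (by omega), ih (k + 1) (by omega)]
    simp

theorem eulerian_succ_self (n : ℕ) : eulerian (n + 1) (n + 1) = 0 := by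
  rw [eulerian_succ_succ, eulerian_eq_zero_of_lt n (n + 1) (by omega)]
  simp

theorem cast_eulerian_succ_succ (n k : ℕ) : (eulerian (n + 1) (k + 1) : ℝ) =
    ((n : ℝ) - k) * eulerian n k + ((k : ℝ) + 2) * eulerian n (k + 1) := by
  rw [eulerian_succ_succ]
  -- Truncated subtraction is harmless: where it differs from the real one, the factor `eulerian n
  -- k` is zero.
  rcases Nat.lt_or_ge n k with h | h
  · rw [eulerian_eq_zero_of_lt n k h]; push_cast; ring
  · push_cast [Nat.cast_sub h]; ring

theorem eulerian_zero_right (n : ℕ) : eulerian n 0 = 1 := by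
  induction n with
  | zero => rw [eulerian]
  | succ n ih => rw [eulerian_succ_zero, ih]

theorem eulerian_pos (n k : ℕ) (h : k ≤ n) : 0 < eulerian (n + 1) k := by
  induction n generalizing k with
  | zero =>
    obtain rfl : k = 0 := by omega
    rw [eulerian_zero_right]; omega
  | succ n ih =>
    cases k with
    | zero => rw [eulerian_zero_right]; omega
    | succ k =>
      rw [eulerian_succ_succ]
      have := ih k (by omega)
      have h2 : 0 < n + 1 - k := by omega
      positivity

/-- Here `A, B, C` are the row `n` entries at `j-1, j, j+1`, and `D, E, F` those at `k-1, k, k+1`.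
Comparing products termwise leaves a surplus `(k-j)(CE + BD)` and a deficit `2(k-j)BE`. These are
reconciled by AM-GM, because `(BE)² ≤ BE · CD = CE · BD`. -/
theorem eulerian_step_aux {A B C D E F j k n : ℝ} (hB : 0 ≤ B) (hC : 0 ≤ C)
    (hD : 0 ≤ D) (hE : 0 ≤ E) (hj : 0 ≤ j) (hjk : j ≤ k) (hkn : k ≤ n)
    (h1 : B * F ≤ C * E) (h2 : A * E ≤ B * D) (h3 : A * F ≤ B * E) (h4 : B * E ≤ C * D) :
    ((n + 1 - j) * A + (j + 1) * B) * ((n - k) * E + (k + 2) * F) ≤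
      ((n - j) * B + (j + 2) * C) * ((n + 1 - k) * D + (k + 1) * E) := by
  have hX : 0 ≤ B * E := mul_nonneg hB hE
  have hu : 0 ≤ C * E := mul_nonneg hC hE
  have hv : 0 ≤ B * D := mul_nonneg hB hD
  have amgm : 2 * (B * E) ≤ C * E + B * D := by
    refine le_of_sq_le_sq ?_ (by linarith)
    have := mul_le_mul_of_nonneg_left h4 hX
    nlinarith [sq_nonneg (C * E - B * D)]
  have c1 : 0 ≤ (j + 1) * (k + 2) := mul_nonneg (by linarith) (by linarith)
  have c2 : 0 ≤ (n + 1 - j) * (n - k) := mul_nonneg (by linarith) (by linarith)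
  have c3 : 0 ≤ (n + 1 - j) * (k + 2) := mul_nonneg (by linarith) (by linarith)
  have c4 : 0 ≤ (j + 2) * (n + 1 - k) := mul_nonneg (by linarith) (by linarith)
  have G1 := mul_le_mul_of_nonneg_left h1 c1
  have G2 := mul_le_mul_of_nonneg_left h2 c2
  have G3 := mul_le_mul_of_nonneg_left h3 c3
  have G4 := mul_le_mul_of_nonneg_left h4 c4
  have G5 := mul_le_mul_of_nonneg_left amgm (sub_nonneg.2 hjk)
  linarith

theorem logConcaveSeq_eulerian (n : ℕ) : LogConcaveSeq fun k => (eulerian n k : ℝ) := by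
  induction n with
  | zero =>
    convert LogConcaveSeq.single using 2 with k
    cases k <;> simp [eulerian]
  | succ n ih =>
    refine ⟨fun k => Nat.cast_nonneg _, fun j k hjk => ?_⟩
    rcases hjk.eq_or_lt with rfl | hlt
    · rw [mul_comm]
    rcases Nat.lt_or_ge n k with hnk | hkn
    · rw [eulerian_eq_zero_of_lt (n + 1) (k + 1) (by omega)]
      push_cast
      rw [mul_zero]
      positivity
    obtain ⟨k, rfl⟩ : ∃ k', k = k' + 1 := ⟨k - 1, by omega⟩
    have hkn' : ((k : ℝ) + 1) ≤ n := by exact_mod_cast hkn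
    have N : ∀ i, (0 : ℝ) ≤ eulerian n i := fun i => Nat.cast_nonneg _
    have hjk' : (j : ℝ) ≤ k + 1 := by exact_mod_cast hjk
    have h1 := ih.mul_le j (k + 1) (by omega)
    have h4 := ih.mul_le j k (by omega)
    cases j with
    | zero =>
      -- At the left edge the entry of index `-1` is taken to be `0`.
      have := eulerian_step_aux (A := 0) (j := 0) (k := k + 1) (n := n) (N 0) (N 1) (N k)
        (N (k + 1)) le_rfl (by positivity) hkn' h1
        (by rw [zero_mul]; exact mul_nonneg (N _) (N _))
        (by rw [zero_mul]; exact mul_nonneg (N _) (N _)) h4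
      rw [cast_eulerian_succ_succ, cast_eulerian_succ_succ, cast_eulerian_succ_succ,
        eulerian_succ_zero]
      push_cast
      linarith
    | succ j =>
      have h2 := ih.mul_le j k (by omega)
      have h3 := ih.mul_le j (k + 1) (by omega)
      have := eulerian_step_aux (j := j + 1) (k := k + 1) (n := n) (N (j + 1))
        (N (j + 1 + 1)) (N k) (N (k + 1)) (by positivity)
        (by exact_mod_cast hjk) hkn' h1 h2 h3 h4
      rw [cast_eulerian_succ_succ, cast_eulerian_succ_succ, cast_eulerian_succ_succ,
        cast_eulerian_succ_succ]
      push_cast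
      linarith

/-! ### Existence and uniqueness for the saddle-point equations -/

/-- Secant slopes of a strictly convex function from a fixed point increase. This gives uniqueness
for both Stirling equations, at `-z` for the second kind and at `-log (1 - z)` for the first. -/
theorem exp_secant_lt {x y : ℝ} (hx : x ≠ 0) (hy : y ≠ 0) (hxy : x < y) :
    (Real.exp x - 1) / x < (Real.exp y - 1) / y := by
  simpa using strictConvexOn_exp.secant_strict_mono (a := 0) (Set.mem_univ _) (Set.mem_univ x)
    (Set.mem_univ y) hx hy hxy

theorem one_sub_exp_neg_pos {z : ℝ} (hz : 0 < z) : 0 < 1 - Real.exp (-z) :=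
  sub_pos.2 (Real.exp_lt_one_iff.2 (neg_lt_zero.2 hz))

theorem exp_sub_one_pos {z : ℝ} (hz : 0 < z) : 0 < Real.exp z - 1 :=
  sub_pos.2 (Real.one_lt_exp_iff.2 hz)

theorem exp_sub_one_ne_zero {z : ℝ} (hz : z ≠ 0) : Real.exp z - 1 ≠ 0 := by
  rwa [sub_ne_zero, Ne, Real.exp_eq_one_iff]

theorem div_one_sub_exp_neg_lt {x y : ℝ} (hx : 0 < x) (hxy : x < y) :
    x / (1 - Real.exp (-x)) < y / (1 - Real.exp (-y)) := by
  have hy : 0 < y := hx.trans hxy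
  have h := exp_secant_lt (x := -y) (y := -x) (by linarith) (by linarith) (by linarith)
  have e : ∀ t : ℝ, (Real.exp (-t) - 1) / (-t) = (1 - Real.exp (-t)) / t := fun t => by
    rw [← neg_div_neg_eq]; ring_nf
  rw [e, e] at h
  have h' := inv_strictAnti₀ (div_pos (one_sub_exp_neg_pos hy) hy) h
  rwa [inv_div, inv_div] at h'

theorem existsUnique_saddleSecond {r : ℝ} (hr : 0 < r) : ∃! z, SaddleSecond r z := by
  have hcont : ContinuousOn (fun z => z / (1 - Real.exp (-z))) (Set.Icc r (1 + r)) := by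
    refine continuousOn_id.div (by fun_prop) fun z hz => ?_
    exact (one_sub_exp_neg_pos (hr.trans_le hz.1)).ne'
  -- Equivalent to `1 + r ≤ e^r`.
  have hlow : r / (1 - Real.exp (-r)) ≤ 1 + r := by
    rw [div_le_iff₀ (one_sub_exp_neg_pos hr)]
    have h1 := Real.add_one_le_exp r
    have h2 : Real.exp r * Real.exp (-r) = 1 := by rw [← Real.exp_add]; simp
    nlinarith [Real.exp_pos (-r)]
  have hhigh : 1 + r ≤ (1 + r) / (1 - Real.exp (-(1 + r))) := by
    rw [le_div_iff₀ (one_sub_exp_neg_pos (by linarith))]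
    nlinarith [Real.exp_pos (-(1 + r))]
  obtain ⟨z, hz, hzr⟩ := intermediate_value_Icc (by linarith) hcont ⟨hlow, hhigh⟩
  refine ⟨z, ⟨hr.trans_le hz.1, hzr⟩, fun y ⟨hy0, hy⟩ => ?_⟩
  have hz0 : 0 < z := hr.trans_le hz.1
  rcases lt_trichotomy y z with h | h | h
  · exact absurd (hy.trans hzr.symm) (div_one_sub_exp_neg_lt hy0 h).ne
  · exact h
  · exact absurd (hy.trans hzr.symm) (div_one_sub_exp_neg_lt hz0 h).ne'

theorem exists_exp_sub_one_div_eq {r : ℝ} (hr : 0 < r) :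
    ∃ w, 0 < w ∧ (Real.exp w - 1) / w = 1 + r := by
  have hlog : 0 < Real.log (1 + r) := Real.log_pos (by linarith)
  have hlog' : Real.log (1 + r) ≤ r := by
    linarith [Real.log_le_sub_one_of_pos (by linarith : 0 < 1 + r)]
  have hcont : ContinuousOn (fun z => (Real.exp z - 1) / z)
      (Set.Icc (Real.log (1 + r)) (2 * r)) :=
    ContinuousOn.div (by fun_prop) continuousOn_id fun z hz => (hlog.trans_le hz.1).ne'
  have hlow : (Real.exp (Real.log (1 + r)) - 1) / Real.log (1 + r) ≤ 1 + r := by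
    rw [div_le_iff₀ hlog, Real.exp_log (by linarith)]
    have := Real.one_sub_inv_le_log_of_pos (by linarith : 0 < 1 + r)
    have h2 : (1 + r) * (1 - (1 + r)⁻¹) = r := by field_simp; ring
    nlinarith
  -- The endpoint `2r` is where `(w + w²/2) / w` equals `1 + r`.
  have hhigh : 1 + r ≤ (Real.exp (2 * r) - 1) / (2 * r) := by
    rw [le_div_iff₀ (by linarith)]
    have := Real.quadratic_le_exp_of_nonneg (by linarith : 0 ≤ 2 * r)
    nlinarith
  obtain ⟨w, hw, hwr⟩ := intermediate_value_Icc (by linarith) hcont ⟨hlow, hhigh⟩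
  exact ⟨w, hlog.trans_le hw.1, hwr⟩

theorem saddleFirst_iff {r z : ℝ} : SaddleFirst r z ↔
    z ∈ Set.Ioo (0 : ℝ) 1 ∧
      (Real.exp (-Real.log (1 - z)) - 1) / (-Real.log (1 - z)) = 1 + r := by
  refine and_congr_right fun hz => ?_
  have h1 : 0 < 1 - z := by linarith [hz.2]
  have h2 : Real.log (1 - z) ≠ 0 := (Real.log_neg h1 (by linarith [hz.1])).ne
  have h3 : z - 1 ≠ 0 := by linarith
  rw [Real.exp_neg, Real.exp_log h1]
  have : z / ((z - 1) * Real.log (1 - z)) = ((1 - z)⁻¹ - 1) / -Real.log (1 - z) := by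
    field_simp
    ring
  rw [this]

theorem existsUnique_saddleFirst {r : ℝ} (hr : 0 < r) : ∃! z, SaddleFirst r z := by
  obtain ⟨w, hw, hwr⟩ := exists_exp_sub_one_div_eq hr
  refine ⟨1 - Real.exp (-w), ?_, fun y hy => ?_⟩
  · refine saddleFirst_iff.2 ⟨⟨one_sub_exp_neg_pos hw, by linarith [Real.exp_pos (-w)]⟩, ?_⟩
    simpa using hwr
  · obtain ⟨⟨hy0, hy1⟩, hy2⟩ := saddleFirst_iff.1 hy
    have h1 : 0 < 1 - y := by linarith
    have h2 : Real.log (1 - y) < 0 := Real.log_neg h1 (by linarith)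
    have h3 : -Real.log (1 - y) = w := by
      rcases lt_trichotomy (-Real.log (1 - y)) w with h | h | h
      · exact absurd (hy2.trans hwr.symm) (exp_secant_lt (by linarith) hw.ne' h).ne
      · exact h
      · exact absurd (hy2.trans hwr.symm) (exp_secant_lt hw.ne' (by linarith) h).ne'
    rw [← h3, neg_neg, Real.exp_log h1]
    ring

theorem uniformTilt_of_ne {z : ℝ} (hz : z ≠ 0) :
    uniformTilt z = Real.exp z / (Real.exp z - 1) - 1 / z := if_neg hz

/-- The reflection `u ↦ 1 - u` of the uniform law; it reduces negative arguments to positive ones.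
-/
theorem uniformTilt_neg (z : ℝ) : uniformTilt (-z) = 1 - uniformTilt z := by
  by_cases hz : z = 0
  · simp [hz, uniformTilt]; norm_num
  · rw [uniformTilt_of_ne hz, uniformTilt_of_ne (neg_ne_zero.2 hz), Real.exp_neg]
    have h1 := exp_sub_one_ne_zero hz
    have h2 := (Real.exp_pos z).ne'
    have h3 : (Real.exp z)⁻¹ - 1 ≠ 0 := by
      rw [← Real.exp_neg]; exact exp_sub_one_ne_zero (neg_ne_zero.2 hz)
    have h4 : (Real.exp z)⁻¹ / ((Real.exp z)⁻¹ - 1) = -1 / (Real.exp z - 1) := by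
      rw [div_eq_div_iff h3 h1]; field_simp; ring
    rw [h4]
    field_simp
    ring

theorem hasDerivAt_uniformTilt {z : ℝ} (hz : 0 < z) :
    HasDerivAt (fun t => Real.exp t / (Real.exp t - 1) - 1 / t)
      (1 / z ^ 2 - Real.exp z / (Real.exp z - 1) ^ 2) z := by
  have h1 := (exp_sub_one_pos hz).ne'
  have h := ((Real.hasDerivAt_exp z).div ((Real.hasDerivAt_exp z).sub_const 1) h1).sub
    (hasDerivAt_inv hz.ne')
  have e : (fun t : ℝ => Real.exp t / (Real.exp t - 1) - 1 / t) =
      ((Real.exp / fun t => Real.exp t - 1) - fun t => t⁻¹) := by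
    ext t; simp
  rw [e]
  refine h.congr_deriv ?_
  field_simp
  ring

theorem strictMonoOn_uniformTilt_Ioi : StrictMonoOn uniformTilt (Set.Ioi 0) := by
  have h : StrictMonoOn (fun t => Real.exp t / (Real.exp t - 1) - 1 / t) (Set.Ioi 0) := by
    refine strictMonoOn_of_deriv_pos (convex_Ioi 0)
      (fun z hz => (hasDerivAt_uniformTilt hz).continuousAt.continuousWithinAt) fun z hz => ?_
    rw [interior_Ioi] at hz
    have hz : 0 < z := hz
    rw [(hasDerivAt_uniformTilt hz).deriv, sub_pos,
      div_lt_div_iff₀ (pow_pos (exp_sub_one_pos hz) 2) (by positivity), one_mul]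
    -- Positivity of the derivative amounts to `z e^{z/2} < e^z - 1`, that is, `z/2 < sinh (z/2)`.
    have h1 := Real.self_lt_sinh_iff.2 (half_pos hz)
    rw [Real.sinh_eq] at h1
    have h2 : Real.exp z = Real.exp (z / 2) ^ 2 := by rw [← Real.exp_nat_mul]; congr 1; ring
    have h3 : Real.exp (z / 2) * Real.exp (-(z / 2)) = 1 := by rw [← Real.exp_add]; simp
    have h4 : z * Real.exp (z / 2) < Real.exp z - 1 := by
      rw [h2]; nlinarith [Real.exp_pos (z / 2)]
    calc Real.exp z * z ^ 2 = (z * Real.exp (z / 2)) ^ 2 := by rw [h2]; ring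
      _ < (Real.exp z - 1) ^ 2 := by
        have : 0 < z * Real.exp (z / 2) := by positivity
        gcongr
  intro x hx y hy hxy
  rw [uniformTilt_of_ne (ne_of_gt hx), uniformTilt_of_ne (ne_of_gt hy)]
  exact h hx hy hxy

/-- Clearing denominators leaves `t + 2 + (t - 2) e^t > 0`, which vanishes at `0` and has derivative
`1 + (t - 1) e^t > 0`. With the reflection, this joins the two half-lines without discussing
continuity at `0`. -/
theorem half_lt_uniformTilt {z : ℝ} (hz : 0 < z) : 1 / 2 < uniformTilt z := by
  have hmono : StrictMonoOn (fun t : ℝ => t + 2 + (t - 2) * Real.exp t) (Set.Ici 0) := by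
    have hd : ∀ t : ℝ, HasDerivAt (fun t : ℝ => t + 2 + (t - 2) * Real.exp t)
        (1 + (t - 1) * Real.exp t) t := fun t => by
      refine (((hasDerivAt_id t).add_const 2).add
        (((hasDerivAt_id t).sub_const 2).mul (Real.hasDerivAt_exp t))).congr_deriv ?_
      simp only [id]
      ring
    refine strictMonoOn_of_deriv_pos (convex_Ici 0)
      (fun t _ => (hd t).continuousAt.continuousWithinAt) fun t ht => ?_
    rw [interior_Ici] at ht
    rw [(hd t).deriv]
    have h1 := Real.add_one_lt_exp (neg_ne_zero.2 (ne_of_gt ht))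
    have h3 : Real.exp t * Real.exp (-t) = 1 := by rw [← Real.exp_add]; simp
    nlinarith [Real.exp_pos t]
  have h := hmono (Set.mem_Ici.2 le_rfl) (Set.mem_Ici.2 hz.le) hz
  simp only [Real.exp_zero] at h
  rw [uniformTilt_of_ne hz.ne', div_sub_div _ _ (exp_sub_one_pos hz).ne' hz.ne',
    div_lt_div_iff₀ two_pos (mul_pos (exp_sub_one_pos hz) hz)]
  nlinarith

theorem uniformTilt_zero : uniformTilt 0 = 1 / 2 := if_pos rfl

theorem uniformTilt_strictMono : StrictMono uniformTilt := by
  intro x y hxy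
  rcases lt_trichotomy x 0 with hx | rfl | hx
  · have h1 := half_lt_uniformTilt (neg_pos.2 hx)
    rw [uniformTilt_neg] at h1
    rcases lt_trichotomy y 0 with hy | rfl | hy
    · have := strictMonoOn_uniformTilt_Ioi (Set.mem_Ioi.2 (neg_pos.2 hy))
        (Set.mem_Ioi.2 (neg_pos.2 hx)) (neg_lt_neg hxy)
      rw [uniformTilt_neg, uniformTilt_neg] at this
      linarith
    · rw [uniformTilt_zero]; linarith
    · linarith [half_lt_uniformTilt hy]
  · rw [uniformTilt_zero]; exact half_lt_uniformTilt hxy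
  · exact strictMonoOn_uniformTilt_Ioi hx (hx.trans hxy) hxy

theorem exists_uniformTilt_eq_of_half_lt {p : ℝ} (h : 1 / 2 < p) (h1 : p < 1) :
    ∃ z, uniformTilt z = p := by
  have hq : 2 < 1 / (1 - p) := by rw [lt_div_iff₀ (by linarith)]; linarith
  have ha : 0 < 1 / (1 - p) - 2 := by linarith
  have hb : 0 < 1 / (1 - p) := by linarith
  -- At `b` the inequality holds because `1 - 1/b = p`. At `a = b - 2`, one has `e^a - 1 ≥ a + a²/2
  -- = ab/2` and `2/(ab) = 1/a - 1/b`.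
  set a := 1 / (1 - p) - 2 with ha_def
  set b := 1 / (1 - p) with hb_def
  have hbp : 1 / b = 1 - p := by rw [hb_def, one_div_one_div]
  have hcont : ContinuousOn (fun t => Real.exp t / (Real.exp t - 1) - 1 / t) (Set.Icc a b) :=
    fun z hz => (hasDerivAt_uniformTilt (ha.trans_le hz.1)).continuousAt.continuousWithinAt
  have hlow : Real.exp a / (Real.exp a - 1) - 1 / a ≤ p := by
    have h2 := Real.quadratic_le_exp_of_nonneg ha.le
    have h3 : Real.exp a / (Real.exp a - 1) = 1 + 1 / (Real.exp a - 1) := by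
      have := (exp_sub_one_pos ha).ne'
      field_simp
      ring
    have h4 : 1 / (Real.exp a - 1) ≤ 1 / (a * b / 2) := by
      refine one_div_le_one_div_of_le (by positivity) ?_
      have : b = a + 2 := by rw [ha_def]; ring
      rw [this]
      nlinarith
    have h5 : 1 / (a * b / 2) = 1 / a - 1 / b := by
      have : b = a + 2 := by rw [ha_def]; ring
      rw [this] at hb ⊢
      field_simp
      ring
    rw [h3]
    linarith
  have hhigh : p ≤ Real.exp b / (Real.exp b - 1) - 1 / b := by
    have h3 : 1 ≤ Real.exp b / (Real.exp b - 1) := by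
      rw [le_div_iff₀ (exp_sub_one_pos hb)]; linarith
    linarith
  obtain ⟨z, hz, hzp⟩ := intermediate_value_Icc (by linarith) hcont ⟨hlow, hhigh⟩
  exact ⟨z, by rw [uniformTilt_of_ne (ha.trans_le hz.1).ne']; exact hzp⟩

theorem existsUnique_saddleEuler {r : ℝ} (hr : 0 < r) : ∃! z, SaddleEuler r z := by
  have h0 : 0 < 1 / (1 + r) := by positivity
  have h1 : 1 / (1 + r) < 1 := by rw [div_lt_one (by linarith)]; linarith
  have hex : ∃ z, uniformTilt z = 1 / (1 + r) := by
    rcases lt_trichotomy (1 / (1 + r)) (1 / 2) with h | h | h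
    · obtain ⟨z, hz⟩ := exists_uniformTilt_eq_of_half_lt (p := 1 - 1 / (1 + r)) (by linarith)
        (by linarith)
      exact ⟨-z, by rw [uniformTilt_neg, hz]; ring⟩
    · exact ⟨0, by rw [uniformTilt_zero, h]⟩
    · exact exists_uniformTilt_eq_of_half_lt h h1
  obtain ⟨z, hz⟩ := hex
  exact ⟨z, hz.symm, fun y hy => uniformTilt_strictMono.injective (hy.symm.trans hz.symm)⟩

/-- With `lam = 1/(1+r)`, the right side is the limit `p₁` has when the Eulerian ratio tends to
`e^{-z}`; it also makes membership in `[0,1]` evident. -/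
theorem one_sub_bernoulliQuotient_div {r z : ℝ} (hr : 0 < r) (h : SaddleEuler r z) :
    1 - bernoulliQuotient z / (1 + r) =
      (1 - 1 / (1 + r)) / (1 - 1 / (1 + r) + 1 / (1 + r) * (Real.exp z)⁻¹) := by
  have h0 : 0 < 1 / (1 + r) := by positivity
  have h1 : 1 / (1 + r) < 1 := by rw [div_lt_one (by linarith)]; linarith
  have hpos : 0 < 1 - 1 / (1 + r) + 1 / (1 + r) * (Real.exp z)⁻¹ :=
    add_pos (by linarith) (by positivity)
  rw [div_eq_mul_one_div (bernoulliQuotient z), eq_div_iff hpos.ne', h]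
  by_cases hz : z = 0
  · subst hz; rw [uniformTilt_zero]; simp [bernoulliQuotient]
  · rw [uniformTilt_of_ne hz, bernoulliQuotient, if_neg hz]
    have h2 := exp_sub_one_ne_zero hz
    have h3 := (Real.exp_pos z).ne'
    field_simp
    ring

/-! ### Growth rates of the generating functions -/

theorem tendsto_growth_of_abs_le {p L c : ℕ → ℝ} {A K : ℝ} (hL : Tendsto L atTop atTop)
    (h : ∀ᶠ i in atTop, |p i - c i - L i * A| ≤ K) :
    Tendsto (fun i => (p i - c i) / L i) atTop (𝓝 A) := by
  rw [tendsto_iff_norm_sub_tendsto_zero]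
  refine squeeze_zero' (Eventually.of_forall fun i => norm_nonneg _) ?_
    (hL.const_div_atTop K)
  filter_upwards [h, hL.eventually_gt_atTop 0] with i hi hLi
  have : (p i - c i) / L i - A = (p i - c i - L i * A) / L i := by field_simp
  rw [this, Real.norm_eq_abs, abs_div, abs_of_pos hLi]
  gcongr

theorem hasSum_of_eq {f g : ℕ → ℝ} {a b : ℝ} (h : HasSum f a) (hf : ∀ k, g k = f k)
    (hb : b = a) : HasSum g b := by
  rw [hb, show g = f from funext hf]
  exact h

section StirlingFirst

theorem hasSum_stirlingFirst (n : ℕ) (x : ℝ) :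
    HasSum (fun k => (Nat.stirlingFirst n k : ℝ) * x ^ k)
      (∏ j ∈ Finset.range n, (x + j)) := by
  induction n with
  | zero =>
    convert hasSum_ite_eq (0 : ℕ) (1 : ℝ) using 2 with k
    · cases k <;> simp
    · simp
  | succ n ih =>
    rw [← hasSum_nat_add_iff' 1, Finset.prod_range_succ]
    have h1 := ((hasSum_nat_add_iff' 1).2 ih).mul_left (n : ℝ)
    have h0 : (n : ℝ) * Nat.stirlingFirst n 0 = 0 := by cases n <;> simp
    refine hasSum_of_eq (h1.add (ih.mul_left x)) (fun k => ?_) ?_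
    · rw [Nat.stirlingFirst_succ_succ]
      push_cast
      ring
    · simp only [Finset.sum_range_one, Nat.stirlingFirst_succ_zero, pow_zero]
      push_cast
      linear_combination h0

/-- With `F(u) = u log u - u`, one has `log u ≤ F(u+1) - F(u) ≤ log (u+1)`, so the errors telescope.
At `x = n t` the final bound no longer depends on `n`. -/
theorem abs_sum_log_sub_le (n : ℕ) {x : ℝ} (hx : 0 < x) :
    |∑ j ∈ Finset.range n, Real.log (x + j) -
      ((x + n) * Real.log (x + n) - (x + n) - (x * Real.log x - x))| ≤
      Real.log (x + n) - Real.log x := by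
  have hstep : ∀ u : ℝ, 0 < u → Real.log u ≤ (u + 1) * Real.log (u + 1) - (u + 1) -
      (u * Real.log u - u) ∧ (u + 1) * Real.log (u + 1) - (u + 1) -
      (u * Real.log u - u) ≤ Real.log (u + 1) := by
    intro u hu
    have h1 := Real.one_sub_inv_le_log_of_pos (x := (u + 1) / u) (by positivity)
    have h2 := Real.log_le_sub_one_of_pos (x := (u + 1) / u) (by positivity)
    rw [Real.log_div (by positivity) hu.ne'] at h1 h2
    have h3 : (u + 1) * (1 - ((u + 1) / u)⁻¹) = 1 := by field_simp; ring
    have h4 : u * ((u + 1) / u - 1) = 1 := by field_simp; ring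
    constructor <;> nlinarith
  rw [abs_le]
  induction n with
  | zero => simp
  | succ n ih =>
    rw [Finset.sum_range_succ]
    obtain ⟨h1, h2⟩ := hstep (x + n) (by positivity)
    push_cast
    rw [← add_assoc]
    constructor <;> linarith [ih.1, ih.2]

theorem tendsto_growth_stirlingFirst {n : ℕ → ℕ} (hn : Tendsto n atTop atTop) {t : ℝ}
    (ht : 0 < t) :
    Tendsto (fun i => (Real.log (∏ j ∈ Finset.range (n i), (n i * t + j)) -
      n i * Real.log (n i)) / n i) atTop
      (𝓝 ((1 + t) * Real.log (1 + t) - t * Real.log t - 1)) := by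
  refine tendsto_growth_of_abs_le (K := Real.log (1 + t) - Real.log t)
    (tendsto_natCast_atTop_atTop.comp hn) ?_
  filter_upwards [hn.eventually_gt_atTop 0] with i hi
  have hi' : (0 : ℝ) < n i := by exact_mod_cast hi
  have h := abs_sum_log_sub_le (n i) (mul_pos hi' ht)
  have e : (n i : ℝ) * t + n i = n i * (1 + t) := by ring
  rw [e, Real.log_mul hi'.ne' ht.ne', Real.log_mul hi'.ne' (by positivity)] at h
  rw [Real.log_prod (fun j _ => by positivity)]
  convert h using 1
  · congr 1; ring
  · ring

end StirlingFirst

section StirlingSecond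

/-- The alternating sum counting the surjections from `m` to `l` letters. -/
noncomputable def surjSum (m l : ℕ) : ℝ :=
  ∑ j ∈ Finset.range (l + 1), (-1) ^ (l + j) * (l.choose j : ℝ) * (j : ℝ) ^ m

theorem hasSum_surjSum (l : ℕ) (z : ℝ) :
    HasSum (fun m => surjSum m l / (m.factorial : ℝ) * z ^ m) ((Real.exp z - 1) ^ l) := by
  have h : ∀ j ∈ Finset.range (l + 1),
      HasSum (fun m => (-1) ^ (l + j) * (l.choose j : ℝ) * ((j * z) ^ m / (m.factorial : ℝ)))
        ((-1) ^ (l + j) * (l.choose j : ℝ) * Real.exp (j * z)) := fun j _ => by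
    have := NormedSpace.expSeries_div_hasSum_exp ((j : ℝ) * z)
    rw [← Real.exp_eq_exp_ℝ] at this
    exact this.mul_left _
  have h2 := hasSum_sum h
  refine hasSum_of_eq h2 (fun m => ?_) ?_
  · rw [surjSum, Finset.sum_div, Finset.sum_mul]
    refine Finset.sum_congr rfl fun j _ => ?_
    rw [mul_pow]
    ring
  · rw [sub_pow]
    refine Finset.sum_congr rfl fun j _ => ?_
    rw [add_comm j l, one_pow, Real.exp_nat_mul]
    ring

theorem surjSum_succ_succ (m l : ℕ) :
    surjSum (m + 1) (l + 1) = (l + 1) * (surjSum m (l + 1) + surjSum m l) := by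
  have e : surjSum m l = ∑ j ∈ Finset.range (l + 1 + 1),
      (-1) ^ (l + j) * (l.choose j : ℝ) * (j : ℝ) ^ m := by
    rw [Finset.sum_range_succ, surjSum]
    simp
  rw [e, surjSum, surjSum, ← Finset.sum_add_distrib, Finset.mul_sum]
  refine Finset.sum_congr rfl fun j _ => ?_
  -- Absorption followed by Pascal's rule, rewritten so that both alternating sums appear.
  have key : ((l + 1).choose j : ℝ) * j = (l + 1) * (((l + 1).choose j : ℝ) - l.choose j) := by
    cases j with
    | zero => simp
    | succ j =>
      have h1 := Nat.add_one_mul_choose_eq l j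
      have h2 := Nat.choose_succ_succ l j
      have h1' : ((l : ℝ) + 1) * l.choose j = (l + 1).choose (j + 1) * (j + 1) := by
        exact_mod_cast h1
      have h2' : ((l + 1).choose (j + 1) : ℝ) = l.choose j + l.choose (j + 1) := by
        exact_mod_cast h2
      push_cast
      rw [← h1', h2']
      ring
  calc (-1 : ℝ) ^ (l + 1 + j) * ((l + 1).choose j : ℝ) * (j : ℝ) ^ (m + 1)
      = (-1) ^ (l + 1 + j) * (((l + 1).choose j : ℝ) * j) * (j : ℝ) ^ m := by ring
    _ = _ := by rw [key]; ring

theorem surjSum_eq (m l : ℕ) : surjSum m l = l.factorial * Nat.stirlingSecond m l := by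
  induction m generalizing l with
  | zero =>
    -- The base case `0 ^ l` is read off from the generating function at `z = 0`.
    have h := (hasSum_surjSum l 0).tsum_eq
    rw [tsum_eq_single 0 (fun m hm => by simp [hm])] at h
    cases l with
    | zero => simpa using h
    | succ l => simpa using h
  | succ m ih =>
    cases l with
    | zero => simp [surjSum]
    | succ l =>
      rw [surjSum_succ_succ, ih, ih, Nat.stirlingSecond_succ_succ, Nat.factorial_succ]
      push_cast
      ring

theorem hasSum_stirlingSecond (l : ℕ) (z : ℝ) :
    HasSum (fun m => (Nat.stirlingSecond m l : ℝ) * ((m.factorial : ℝ))⁻¹ * z ^ m)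
      ((Real.exp z - 1) ^ l / l.factorial) := by
  refine hasSum_of_eq ((hasSum_surjSum l z).div_const (l.factorial : ℝ)) (fun m => ?_) rfl
  rw [surjSum_eq]
  have := l.factorial_ne_zero
  field_simp

end StirlingSecond

theorem eulerian_symm (n k j : ℕ) (h : k + j = n) : eulerian (n + 1) k = eulerian (n + 1) j := by
  induction n generalizing k j with
  | zero =>
    obtain rfl : k = 0 := by omega
    obtain rfl : j = 0 := by omega
    rfl
  | succ n ih =>
    have hlast : eulerian (n + 2) (n + 1) = 1 := by
      rw [eulerian_succ_succ, eulerian_succ_self, ih n 0 (by omega), eulerian_zero_right]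
      simp
    cases k with
    | zero =>
      obtain rfl : j = n + 1 := by omega
      rw [eulerian_zero_right, hlast]
    | succ k =>
      cases j with
      | zero =>
        obtain rfl : k = n := by omega
        rw [eulerian_zero_right, hlast]
      | succ j =>
        rw [eulerian_succ_succ (n + 1) k, eulerian_succ_succ (n + 1) j, ih k (j + 1) (by omega),
          ih (k + 1) j (by omega)]
        rw [show n + 1 - k = j + 2 by omega, show n + 1 - j = k + 2 by omega, add_comm]

/-- Multiplication by `c + 1` splits each Worpitzky term with exactly the two Eulerian weights,
which drives the induction in `worpitzky`. -/
theorem succ_mul_choose_eq_add (c n k : ℕ) (h : k ≤ n) :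
    (c + 1) * (c + n - k).choose n =
      (k + 1) * (c + n + 1 - k).choose (n + 1) + (n - k) * (c + n - k).choose (n + 1) := by
  obtain ⟨d, rfl⟩ := Nat.exists_eq_add_of_le h
  rw [show c + (k + d) - k = c + d by omega, show c + (k + d) + 1 - k = c + d + 1 by omega,
    show k + d - k = d by omega, Nat.choose_succ_succ]
  have h1 := Nat.choose_succ_right_eq (c + d) (k + d)
  rcases Nat.lt_or_ge c k with hck | hck
  · rw [Nat.choose_eq_zero_of_lt (show c + d < k + d by omega),
      Nat.choose_eq_zero_of_lt (show c + d < k + d + 1 by omega)]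
    simp
  · obtain ⟨e, rfl⟩ := Nat.exists_eq_add_of_le hck
    rw [show k + e + d - (k + d) = e by omega] at h1
    linarith

/-- Worpitzky's identity. -/
theorem worpitzky (n c : ℕ) :
    (c + 1) ^ n = ∑ k ∈ Finset.range (n + 1), eulerian n k * (c + n - k).choose n := by
  induction n with
  | zero => simp [eulerian]
  | succ n ih =>
    have h1 : (c + 1) ^ (n + 1) = ∑ k ∈ Finset.range (n + 1),
        ((k + 1) * eulerian n k * (c + n + 1 - k).choose (n + 1) +
          (n - k) * eulerian n k * (c + n - k).choose (n + 1)) := by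
      rw [pow_succ, ih, Finset.sum_mul]
      refine Finset.sum_congr rfl fun k hk => ?_
      rw [mul_assoc, mul_comm _ (c + 1),
        succ_mul_choose_eq_add c n k (Nat.lt_succ_iff.1 (Finset.mem_range.1 hk))]
      ring
    have h2 : ∑ k ∈ Finset.range (n + 1), (k + 1) * eulerian n k * (c + n + 1 - k).choose (n + 1)
        = ∑ k ∈ Finset.range (n + 1), (k + 2) * eulerian n (k + 1) *
          (c + n - k).choose (n + 1) + eulerian n 0 * (c + n + 1).choose (n + 1) := by
      have h3 : ∑ k ∈ Finset.range (n + 1 + 1),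
          (k + 1) * eulerian n k * (c + n + 1 - k).choose (n + 1) = ∑ k ∈ Finset.range (n + 1),
          (k + 1) * eulerian n k * (c + n + 1 - k).choose (n + 1) := by
        rw [Finset.sum_range_succ, eulerian_eq_zero_of_lt n (n + 1) (by omega)]
        simp
      rw [← h3, Finset.sum_range_succ']
      congr 1
      · refine Finset.sum_congr rfl fun k _ => ?_
        rw [show c + n + 1 - (k + 1) = c + n - k by omega]
      · simp
    rw [h1, Finset.sum_add_distrib, h2, Finset.sum_range_succ' _ (n + 1), eulerian_succ_zero,
      add_right_comm, ← Finset.sum_add_distrib]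
    congr 1
    refine Finset.sum_congr rfl fun k _ => ?_
    rw [eulerian_succ_succ, show c + (n + 1) - (k + 1) = c + n - k by omega]
    ring

/-- The Eulerian polynomial. -/
noncomputable def eulerianPoly (n : ℕ) (x : ℝ) : ℝ :=
  ∑ k ∈ Finset.range (n + 1), (eulerian n k : ℝ) * x ^ k

theorem hasSum_eulerian (n : ℕ) (x : ℝ) :
    HasSum (fun k => (eulerian n k : ℝ) * x ^ k) (eulerianPoly n x) := by
  refine hasSum_sum_of_ne_finset_zero fun k hk => ?_
  rw [eulerian_eq_zero_of_lt n k (by simpa using hk)]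
  simp

theorem hasSum_choose_shift_mul_geometric {n k : ℕ} (h : k ≤ n) {x : ℝ} (hx0 : 0 ≤ x)
    (hx1 : x < 1) :
    HasSum (fun c => ((c + n - k).choose n : ℝ) * x ^ c) (x ^ k / (1 - x) ^ (n + 1)) := by
  rw [← hasSum_nat_add_iff' k]
  have h0 : ∑ c ∈ Finset.range k, ((c + n - k).choose n : ℝ) * x ^ c = 0 := by
    refine Finset.sum_eq_zero fun c hc => ?_
    have := Finset.mem_range.1 hc
    rw [Nat.choose_eq_zero_of_lt (by omega)]
    simp
  rw [h0, sub_zero]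
  have h1 := (hasSum_choose_mul_geometric_of_norm_lt_one n
    (by rwa [Real.norm_of_nonneg hx0] : ‖x‖ < 1)).mul_left (x ^ k)
  refine hasSum_of_eq h1 (fun c => ?_) ?_
  · rw [show c + k + n - k = c + n by omega]
    ring
  · ring

theorem hasSum_succ_pow_mul_geometric (n : ℕ) {x : ℝ} (hx0 : 0 ≤ x) (hx1 : x < 1) :
    HasSum (fun c : ℕ => ((c : ℝ) + 1) ^ n * x ^ c) (eulerianPoly n x / (1 - x) ^ (n + 1)) := by
  have h := hasSum_sum (s := Finset.range (n + 1))
    (f := fun k c => (eulerian n k : ℝ) * (((c + n - k).choose n : ℝ) * x ^ c))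
    (fun k hk => (hasSum_choose_shift_mul_geometric
      (Nat.lt_succ_iff.1 (Finset.mem_range.1 hk)) hx0 hx1).mul_left (eulerian n k : ℝ))
  refine hasSum_of_eq h (fun c => ?_) ?_
  · have : ((c : ℝ) + 1) ^ n = ((c + 1) ^ n : ℕ) := by push_cast; rfl
    rw [this, worpitzky, Nat.cast_sum, Finset.sum_mul]
    refine Finset.sum_congr rfl fun k _ => ?_
    push_cast
    ring
  · rw [eulerianPoly, Finset.sum_div]
    refine Finset.sum_congr rfl fun k _ => ?_
    ring

theorem continuous_pow_mul_exp (n : ℕ) (z : ℝ) :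
    Continuous fun s : ℝ => s ^ n * Real.exp (-(z * s)) := by fun_prop

theorem tendsto_integral_pow_mul_exp (n : ℕ) {z : ℝ} (hz : 0 < z) :
    Tendsto (fun N : ℕ => ∫ s in (0 : ℝ)..N, s ^ n * Real.exp (-(z * s))) atTop
      (𝓝 (n.factorial / z ^ (n + 1))) := by
  have hval : ∫ s in Set.Ioi (0 : ℝ), s ^ n * Real.exp (-(z * s)) =
      n.factorial / z ^ (n + 1) := by
    have h := Real.integral_rpow_mul_exp_neg_mul_Ioi (a := n + 1) (by positivity) hz
    rw [Real.Gamma_nat_eq_factorial] at h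
    simp only [add_sub_cancel_right, Real.rpow_natCast] at h
    rw [h, show ((n : ℝ) + 1) = ((n + 1 : ℕ) : ℝ) by push_cast; rfl, Real.rpow_natCast]
    rw [one_div, inv_pow]
    field_simp
  have hint : MeasureTheory.IntegrableOn (fun s : ℝ => s ^ n * Real.exp (-(z * s)))
      (Set.Ioi 0) := by
    -- A non-integrable function would have integral `0`, contradicting the positive Gamma value.
    by_contra hcon
    rw [MeasureTheory.integral_undef hcon] at hval
    have : (0 : ℝ) < n.factorial / z ^ (n + 1) := by positivity
    linarith
  rw [← hval]
  exact MeasureTheory.intervalIntegral_tendsto_integral_Ioi 0 hint tendsto_natCast_atTop_atTop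

theorem sum_integral_pow_mul_exp (n N : ℕ) (z : ℝ) :
    ∑ c ∈ Finset.range N, ∫ s in (c : ℝ)..(c + 1 : ℝ), s ^ n * Real.exp (-(z * s)) =
      ∫ s in (0 : ℝ)..N, s ^ n * Real.exp (-(z * s)) := by
  have := intervalIntegral.sum_integral_adjacent_intervals (a := fun k : ℕ => (k : ℝ))
    (μ := MeasureTheory.volume) (n := N) (f := fun s : ℝ => s ^ n * Real.exp (-(z * s)))
    fun k _ => (continuous_pow_mul_exp n z).intervalIntegrable _ _
  simpa using this

theorem integral_le_term (n c : ℕ) {z : ℝ} (hz : 0 < z) :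
    ∫ s in (c : ℝ)..(c + 1 : ℝ), s ^ n * Real.exp (-(z * s)) ≤
      ((c : ℝ) + 1) ^ n * Real.exp (-z) ^ c := by
  have h : ∫ s in (c : ℝ)..(c + 1 : ℝ), s ^ n * Real.exp (-(z * s)) ≤
      ∫ _ in (c : ℝ)..(c + 1 : ℝ), ((c : ℝ) + 1) ^ n * Real.exp (-z) ^ c := by
    refine intervalIntegral.integral_mono_on (by linarith)
      ((continuous_pow_mul_exp n z).intervalIntegrable _ _) (by simp) fun s hs => ?_
    have hc : (0 : ℝ) ≤ c := by positivity
    rw [← Real.exp_nat_mul]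
    have h1 : s ^ n ≤ ((c : ℝ) + 1) ^ n := pow_le_pow_left₀ (hc.trans hs.1) hs.2 n
    have h2 : -(z * s) ≤ c * -z := by nlinarith [hs.1]
    gcongr
  simpa using h

/-- The interval is shifted to `[c+1, c+2]` so that `s ^ n ≥ (c+1) ^ n`; the exponential then loses
at most `e^{-2z}`, independently of `n`. -/
theorem term_le_integral (n c : ℕ) {z : ℝ} (hz : 0 < z) :
    ((c : ℝ) + 1) ^ n * Real.exp (-z) ^ c ≤ Real.exp (2 * z) *
      ∫ s in ((c + 1 : ℕ) : ℝ)..((c + 1 : ℕ) + 1 : ℝ), s ^ n * Real.exp (-(z * s)) := by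
  have h : ∫ _ in ((c + 1 : ℕ) : ℝ)..((c + 1 : ℕ) + 1 : ℝ),
      ((c : ℝ) + 1) ^ n * Real.exp (-(z * (c + 2))) ≤
      ∫ s in ((c + 1 : ℕ) : ℝ)..((c + 1 : ℕ) + 1 : ℝ), s ^ n * Real.exp (-(z * s)) := by
    refine intervalIntegral.integral_mono_on (by linarith) (by simp)
      ((continuous_pow_mul_exp n z).intervalIntegrable _ _) fun s hs => ?_
    push_cast at hs
    have hc : (0 : ℝ) ≤ c := by positivity
    have h1 : ((c : ℝ) + 1) ^ n ≤ s ^ n := pow_le_pow_left₀ (by positivity) hs.1 n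
    have h2 : -(z * (c + 2)) ≤ -(z * s) := by nlinarith [hs.2]
    have h3 : 0 ≤ s ^ n := le_trans (by positivity) h1
    gcongr
  have h' := mul_le_mul_of_nonneg_left h (Real.exp_pos (2 * z)).le
  refine le_trans (le_of_eq ?_) h'
  rw [intervalIntegral.integral_const, add_sub_cancel_left, one_smul, ← Real.exp_nat_mul,
    mul_left_comm, ← Real.exp_add]
  congr 2
  ring

theorem eulerianPoly_exp_bounds (n : ℕ) {z : ℝ} (hz : 0 < z) :
    n.factorial / z ^ (n + 1) ≤
        eulerianPoly n (Real.exp (-z)) / (1 - Real.exp (-z)) ^ (n + 1) ∧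
      eulerianPoly n (Real.exp (-z)) / (1 - Real.exp (-z)) ^ (n + 1) ≤
        Real.exp (2 * z) * (n.factorial / z ^ (n + 1)) := by
  have hs := hasSum_succ_pow_mul_geometric n (Real.exp_pos (-z)).le
    (Real.exp_lt_one_iff.2 (neg_lt_zero.2 hz))
  have hI := tendsto_integral_pow_mul_exp n hz
  constructor
  · refine le_of_tendsto hI (Eventually.of_forall fun N => ?_)
    rw [← sum_integral_pow_mul_exp]
    exact (Finset.sum_le_sum fun c _ => integral_le_term n c hz).trans
      (sum_le_hasSum _ (fun c _ => by positivity) hs)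
  · refine le_of_tendsto_of_tendsto' hs.tendsto_sum_nat
      ((hI.comp (tendsto_add_atTop_nat 1)).const_mul _) fun N => ?_
    simp only [Function.comp_apply]
    rw [← sum_integral_pow_mul_exp, Finset.sum_range_succ']
    have h0 : 0 ≤ ∫ s in ((0 : ℕ) : ℝ)..((0 : ℕ) + 1 : ℝ), s ^ n * Real.exp (-(z * s)) := by
      refine intervalIntegral.integral_nonneg (by simp) fun s hs => ?_
      have : 0 ≤ s := by simpa using hs.1
      positivity
    refine (Finset.sum_le_sum fun c _ => term_le_integral n c hz).trans ?_
    rw [← Finset.mul_sum]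
    gcongr
    linarith

/-- As `Real.log` is even, for `x = e^{-z}` the rate is `log ((1 - x) / z)`, and one formula serves
both `x < 1` and `x > 1`. -/
theorem abs_log_eulerianPoly_sub_le_of_lt_one (n : ℕ) {x : ℝ} (hx0 : 0 < x) (hx1 : x < 1) :
    |Real.log (eulerianPoly n x) - Real.log n.factorial -
      (n + 1) * (Real.log (x - 1) - Real.log (Real.log x))| ≤ -2 * Real.log x := by
  obtain ⟨z, rfl⟩ : ∃ z, x = Real.exp (-z) := ⟨-Real.log x, by rw [neg_neg, Real.exp_log hx0]⟩
  have hz : 0 < z := by linarith [Real.exp_lt_one_iff.1 hx1]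
  have h1 := one_sub_exp_neg_pos hz
  obtain ⟨hl, hu⟩ := eulerianPoly_exp_bounds n hz
  have hpos : 0 < eulerianPoly n (Real.exp (-z)) := by
    by_contra hcon
    have h2 : (0 : ℝ) < n.factorial / z ^ (n + 1) := by positivity
    exact absurd (h2.trans_le hl) (not_lt.2 (div_nonpos_of_nonpos_of_nonneg
      (not_lt.1 hcon) (by positivity)))
  have e1 : Real.log (Real.exp (-z) - 1) = Real.log (1 - Real.exp (-z)) := by
    rw [← Real.log_neg_eq_log, neg_sub]
  have hf : (n.factorial : ℝ) ≠ 0 := by positivity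
  have hl' := Real.log_le_log (by positivity) hl
  have hu' := Real.log_le_log (by positivity) hu
  rw [Real.log_mul (Real.exp_pos _).ne' (by positivity), Real.log_exp] at hu'
  rw [Real.log_div hpos.ne' (by positivity), Real.log_div hf (by positivity), Real.log_pow,
    Real.log_pow] at hl' hu'
  push_cast at hl' hu'
  rw [e1, Real.log_exp, Real.log_neg_eq_log, abs_le]
  constructor <;> linarith

theorem eulerianPoly_succ_inv (n : ℕ) {x : ℝ} (hx : 0 < x) :
    eulerianPoly (n + 1) x = x ^ n * eulerianPoly (n + 1) x⁻¹ := by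
  have e : ∀ y, eulerianPoly (n + 1) y =
      ∑ k ∈ Finset.range (n + 1), (eulerian (n + 1) k : ℝ) * y ^ k := fun y => by
    rw [eulerianPoly, Finset.sum_range_succ, eulerian_succ_self]
    simp
  rw [e, e, ← Finset.sum_range_reflect, Finset.mul_sum]
  refine Finset.sum_congr rfl fun k hk => ?_
  have hk' : k ≤ n := Nat.lt_succ_iff.1 (Finset.mem_range.1 hk)
  obtain ⟨j, rfl⟩ := Nat.exists_eq_add_of_le hk'
  rw [show k + j + 1 - 1 - k = j by omega, eulerian_symm (k + j) j k (by omega), pow_add, inv_pow]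
  field_simp

/-- The range `x > 1` is carried to `x⁻¹ < 1` by the palindromic symmetry of the Eulerian
polynomials. -/
theorem tendsto_growth_eulerian {n : ℕ → ℕ} (hn : Tendsto n atTop atTop) {x : ℝ}
    (hx0 : 0 < x) (hx1 : x ≠ 1) :
    Tendsto (fun i => (Real.log (eulerianPoly (n i) x) - Real.log (n i).factorial) / n i) atTop
      (𝓝 (Real.log (x - 1) - Real.log (Real.log x))) := by
  have hL := tendsto_natCast_atTop_atTop (R := ℝ).comp hn
  rcases lt_or_gt_of_ne hx1 with hx | hx
  · refine tendsto_growth_of_abs_le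
      (K := |Real.log (x - 1) - Real.log (Real.log x)| + -2 * Real.log x) hL
      (Eventually.of_forall fun i => ?_)
    have h := abs_log_eulerianPoly_sub_le_of_lt_one (n i) hx0 hx
    have h2 := abs_add_le (Real.log (x - 1) - Real.log (Real.log x))
      (Real.log (eulerianPoly (n i) x) - Real.log (n i).factorial -
      (n i + 1) * (Real.log (x - 1) - Real.log (Real.log x)))
    refine le_trans (le_of_eq ?_) (h2.trans (add_le_add le_rfl h))
    congr 1
    ring
  · have hxi0 : 0 < x⁻¹ := inv_pos.2 hx0
    have hxi : x⁻¹ < 1 := inv_lt_one_of_one_lt₀ hx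
    have e : Real.log (x⁻¹ - 1) - Real.log (Real.log x⁻¹) =
        Real.log (x - 1) - Real.log (Real.log x) - Real.log x := by
      have h3 : x⁻¹ - 1 = -((x - 1) / x) := by field_simp; ring
      rw [h3, Real.log_inv, Real.log_neg_eq_log, Real.log_neg_eq_log,
        Real.log_div (by linarith) hx0.ne']
      ring
    refine tendsto_growth_of_abs_le
      (K := |Real.log (x - 1) - Real.log (Real.log x) - 2 * Real.log x| + -2 * Real.log x⁻¹) hL ?_
    filter_upwards [hn.eventually_gt_atTop 0] with i hi
    obtain ⟨k, hk⟩ : ∃ k, n i = k + 1 := ⟨n i - 1, by omega⟩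
    have h := abs_log_eulerianPoly_sub_le_of_lt_one (n i) hxi0 hxi
    rw [e] at h
    have hpos : eulerianPoly (n i) x⁻¹ ≠ 0 := by
      refine ne_of_gt (lt_of_lt_of_le zero_lt_one ?_)
      have := (logConcaveSeq_eulerian (n i)).term_le hxi0 (hasSum_eulerian _ _) 0
      simpa [eulerian_zero_right] using this
    have e2 : Real.log (eulerianPoly (n i) x) =
        (n i - 1) * Real.log x + Real.log (eulerianPoly (n i) x⁻¹) := by
      rw [hk] at hpos ⊢
      rw [eulerianPoly_succ_inv k hx0, Real.log_mul (by positivity) hpos, Real.log_pow]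
      push_cast
      ring
    have h2 := abs_add_le (Real.log (x - 1) - Real.log (Real.log x) - 2 * Real.log x)
      (Real.log (eulerianPoly (n i) x⁻¹) - Real.log (n i).factorial -
      (n i + 1) * (Real.log (x - 1) - Real.log (Real.log x) - Real.log x))
    refine le_trans (le_of_eq ?_) (h2.trans (add_le_add le_rfl h))
    congr 1
    rw [e2]
    ring

/-! ### Limits of the transition probabilities -/

theorem p₁_succ_succ (a : ℕ → ℕ → ℝ) (T : ℕ → ℕ → ℕ) (n k : ℕ) : p₁ a T (n + 1) (k + 1) =
    a (n + 1) (k + 1) * (T n k : ℝ) / (T (n + 1) (k + 1) : ℝ) := rfl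

section Sequences

variable {m l : ℕ → ℕ} {q : ℝ}

theorem tendsto_natCast_inv (hm : Tendsto m atTop atTop) :
    Tendsto (fun i => ((m i : ℝ))⁻¹) atTop (𝓝 0) :=
  tendsto_inv_atTop_zero.comp (tendsto_natCast_atTop_atTop.comp hm)

theorem tendsto_pred_div_self (hm : Tendsto m atTop atTop) :
    Tendsto (fun i => ((m i - 1 : ℕ) : ℝ) / m i) atTop (𝓝 1) := by
  have h : Tendsto (fun i => 1 - ((m i : ℝ))⁻¹) atTop (𝓝 (1 - 0)) :=
    tendsto_const_nhds.sub (tendsto_natCast_inv hm)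
  rw [sub_zero] at h
  refine h.congr' ?_
  filter_upwards [hm.eventually_gt_atTop 0] with i hi
  have hi' : (m i : ℝ) ≠ 0 := by exact_mod_cast hi.ne'
  rw [Nat.cast_pred hi]
  field_simp

theorem tendsto_pred_div (hm : Tendsto m atTop atTop)
    (h : Tendsto (fun i => (m i : ℝ) / l i) atTop (𝓝 q)) :
    Tendsto (fun i => ((m i - 1 : ℕ) : ℝ) / l i) atTop (𝓝 q) := by
  have h' := (tendsto_pred_div_self hm).mul h
  rw [one_mul] at h'
  refine h'.congr' ?_
  filter_upwards [hm.eventually_gt_atTop 0] with i hi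
  have hi' : (m i : ℝ) ≠ 0 := by exact_mod_cast hi.ne'
  field_simp

theorem tendsto_pred_div_pred (hq : q ≠ 0) (hm : Tendsto m atTop atTop)
    (hl : Tendsto l atTop atTop) (h : Tendsto (fun i => (m i : ℝ) / l i) atTop (𝓝 q)) :
    Tendsto (fun i => ((l i - 1 : ℕ) : ℝ) / (m i - 1 : ℕ)) atTop (𝓝 q⁻¹) := by
  have h1 := (tendsto_pred_div hm h).inv₀ hq
  have h2 : Tendsto (fun i => (l i : ℝ) / (m i - 1 : ℕ)) atTop (𝓝 q⁻¹) := by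
    simpa only [inv_div] using h1
  exact tendsto_pred_div hl h2

theorem eventually_lt_of_tendsto_div (hq : q < 1) (hm : Tendsto m atTop atTop)
    (h : Tendsto (fun i => (l i : ℝ) / m i) atTop (𝓝 q)) : ∀ᶠ i in atTop, l i < m i := by
  filter_upwards [h.eventually_lt_const hq, hm.eventually_gt_atTop 0] with i hi hi0
  rw [div_lt_one (by exact_mod_cast hi0)] at hi
  exact_mod_cast hi

theorem tendsto_pred (hm : Tendsto m atTop atTop) : Tendsto (fun i => m i - 1) atTop atTop :=
  (tendsto_sub_atTop_nat 1).comp hm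

end Sequences

theorem inv_one_add_lt_one {r : ℝ} (hr : 0 < r) : (1 + r)⁻¹ < 1 :=
  inv_lt_one_of_one_lt₀ (by linarith)

section Limits

variable {r z : ℝ} {m l : ℕ → ℕ}

theorem tendsto_p₁_choose (hr : 0 < r) (hm : Tendsto m atTop atTop) (hl : Tendsto l atTop atTop)
    (h : Tendsto (fun i => (m i : ℝ) / l i) atTop (𝓝 (1 + r))) :
    Tendsto (fun i => p₁ (fun _ _ => 1) Nat.choose (m i) (l i)) atTop (𝓝 (1 / (1 + r))) := by
  have h1 := h.inv₀ (by linarith : 1 + r ≠ 0)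
  rw [one_div]
  refine h1.congr' ?_
  have hlm : ∀ᶠ i in atTop, l i < m i := by
    refine eventually_lt_of_tendsto_div (inv_one_add_lt_one hr) hm ?_
    simpa only [inv_div] using h1
  filter_upwards [hlm, hl.eventually_gt_atTop 0] with i hi hi0
  obtain ⟨k, hk⟩ : ∃ k, l i = k + 1 := ⟨l i - 1, by omega⟩
  obtain ⟨n, hn⟩ : ∃ n, m i = n + 1 := ⟨m i - 1, by omega⟩
  have hpos : (0 : ℝ) < (n + 1).choose (k + 1) := by
    exact_mod_cast Nat.choose_pos (by omega)
  have e : ((n : ℝ) + 1) * n.choose k = (n + 1).choose (k + 1) * (k + 1) := by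
    exact_mod_cast Nat.add_one_mul_choose_eq n k
  rw [hk, hn, p₁_succ_succ, inv_div, eq_div_iff hpos.ne']
  push_cast
  field_simp
  linarith

/-- The ratio theorem is applied along column `l`, at position `m - 1`, to `S(·,l) / (·)!`. It gives
`l S(m-1,l) / S(m,l) → z / (1+r) = 1 - e^{-z}`. -/
theorem tendsto_p₁_stirlingSecond (hr : 0 < r) (hz : SaddleSecond r z)
    (hm : Tendsto m atTop atTop) (hl : Tendsto l atTop atTop)
    (h : Tendsto (fun i => (m i : ℝ) / l i) atTop (𝓝 (1 + r))) :
    Tendsto (fun i => p₁ (fun _ _ => 1) Nat.stirlingSecond (m i) (l i)) atTop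
      (𝓝 (Real.exp (-z))) := by
  obtain ⟨hz0, hzr⟩ := hz
  have hlm : ∀ᶠ i in atTop, l i < m i - 1 := by
    refine eventually_lt_of_tendsto_div (inv_one_add_lt_one hr) (tendsto_pred hm) ?_
    simpa only [inv_div] using (tendsto_pred_div hm h).inv₀ (by linarith : 1 + r ≠ 0)
  have hpos : ∀ᶠ i in atTop, (0 : ℝ) < Nat.stirlingSecond (m i - 1) (l i) := by
    filter_upwards [hlm, hl.eventually_gt_atTop 0] with i hi hi0
    have := stirlingSecond_pos (m i - 2) (l i - 1) (by omega)
    rw [show m i - 2 + 1 = m i - 1 by omega, show l i - 1 + 1 = l i by omega] at this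
    exact_mod_cast this
  have key := tendsto_ratio (x₀ := z) (lam := 1 + r) (l := fun i => m i - 1)
    (a := fun i k => (Nat.stirlingSecond k (l i) : ℝ) * ((k.factorial : ℝ))⁻¹)
    (P := fun i y => (Real.exp y - 1) ^ l i / (l i).factorial) (L := fun i => (l i : ℝ))
    (c := fun i => -Real.log (l i).factorial) (Λ := fun y => Real.log (Real.exp y - 1))
    (h := fun y => y / (1 - Real.exp (-y))) hz0
    (fun i => (logConcaveSeq_stirlingSecond_left (l i)).mul LogConcaveSeq.inv_factorial)
    (fun i y _ => hasSum_stirlingSecond (l i) y)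
    (by filter_upwards [hpos] with i hi; positivity)
    (tendsto_natCast_atTop_atTop.comp hl) (tendsto_pred_div hm h)
    (by
      filter_upwards [eventually_nhdsWithin_of_eventually_nhds (eventually_gt_nhds hz0)] with y hy
      have hy1 := exp_sub_one_pos hy
      constructor
      · refine (((Real.hasDerivAt_exp y).sub_const 1).log hy1.ne').congr_deriv ?_
        have h1 := (one_sub_exp_neg_pos hy).ne'
        have h2 : 1 - Real.exp (-y) = (Real.exp y - 1) / Real.exp y := by
          rw [Real.exp_neg]; field_simp
        rw [h2]
        have h3 := hy1.ne'
        field_simp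
      · refine tendsto_const_nhds.congr' ?_
        filter_upwards [hl.eventually_gt_atTop 0] with i hi
        have hi' : (l i : ℝ) ≠ 0 := by exact_mod_cast hi.ne'
        rw [Real.log_div (by positivity) (by positivity), Real.log_pow]
        field_simp
        ring)
    (fun y hy hyz => by rw [← hzr]; exact div_one_sub_exp_neg_lt hy hyz)
    (fun y hyz => by rw [← hzr]; exact div_one_sub_exp_neg_lt hz0 hyz)
  have hlim := (tendsto_const_nhds (x := (1 : ℝ))).sub
    ((h.inv₀ (by linarith : 1 + r ≠ 0)).mul (key.inv₀ (inv_ne_zero hz0.ne')))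
  have hval : 1 - (1 + r)⁻¹ * z⁻¹⁻¹ = Real.exp (-z) := by
    rw [← hzr, inv_div, inv_inv]
    field_simp
    ring
  rw [hval] at hlim
  refine hlim.congr' ?_
  filter_upwards [hlm, hpos, hl.eventually_gt_atTop 0] with i hi hp hi0
  obtain ⟨k, hk⟩ : ∃ k, l i = k + 1 := ⟨l i - 1, by omega⟩
  obtain ⟨n, hn⟩ : ∃ n, m i = n + 1 := ⟨m i - 1, by omega⟩
  rw [hk, hn, Nat.add_sub_cancel] at hp
  rw [hk, hn, p₁_succ_succ, Nat.add_sub_cancel, Nat.stirlingSecond_succ_succ, Nat.factorial_succ]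
  have hD : (0 : ℝ) < ((k + 1 : ℝ)) * Nat.stirlingSecond n (k + 1) + Nat.stirlingSecond n k :=
    add_pos_of_pos_of_nonneg (by positivity) (by positivity)
  have hf : (n.factorial : ℝ) ≠ 0 := by positivity
  push_cast
  field_simp
  ring

/-- The weight `b = n` is absorbed by rescaling row `n` to `T(n,k) n^k`; then `p₁ = 1 / (1 +
ratio)`, and the saddle point `(1-z)/z` yields `1 - z`. -/
theorem tendsto_p₁_stirlingFirst (hr : 0 < r) (hz : SaddleFirst r z)
    (hm : Tendsto m atTop atTop) (hl : Tendsto l atTop atTop)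
    (h : Tendsto (fun i => (m i : ℝ) / l i) atTop (𝓝 (1 + r))) :
    Tendsto (fun i => p₁ (fun _ _ => 1) Nat.stirlingFirst (m i) (l i)) atTop
      (𝓝 (1 - z)) := by
  obtain ⟨⟨hz0, hz1⟩, hzr⟩ := saddleFirst_iff.1 hz
  have h1z : 0 < 1 - z := by linarith
  have hx₀ : 0 < (1 - z) / z := by positivity
  have hdiv := tendsto_pred_div_pred (by linarith : 1 + r ≠ 0) hm hl h
  have hlm := eventually_lt_of_tendsto_div (inv_one_add_lt_one hr) (tendsto_pred hm) hdiv
  have hpos : ∀ᶠ i in atTop, (0 : ℝ) < Nat.stirlingFirst (m i - 1) (l i - 1) := by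
    filter_upwards [hlm, hl.eventually_gt_atTop 1] with i hi hi0
    have := stirlingFirst_pos (m i - 2) (l i - 2) (by omega)
    rw [show m i - 2 + 1 = m i - 1 by omega, show l i - 2 + 1 = l i - 1 by omega] at this
    exact_mod_cast this
  have hw : ∀ y : ℝ, 0 < y → 0 < Real.log (1 + y⁻¹) := fun y hy =>
    Real.log_pos (by linarith [inv_pos.2 hy])
  -- The function `y log (1 + 1/y)` is the reciprocal secant slope of `exp` at `w = log (1 + 1/y)`.
  have hE : ∀ y : ℝ, 0 < y → y * Real.log (1 + y⁻¹) =
      ((Real.exp (Real.log (1 + y⁻¹)) - 1) / Real.log (1 + y⁻¹))⁻¹ := fun y hy => by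
    rw [Real.exp_log (by positivity), inv_div, add_sub_cancel_left, div_inv_eq_mul, mul_comm]
  have hlt : ∀ x y : ℝ, 0 < x → x < y →
      x * Real.log (1 + x⁻¹) < y * Real.log (1 + y⁻¹) := fun x y hx hxy => by
    have hy := hx.trans hxy
    rw [hE x hx, hE y hy]
    have hlog : Real.log (1 + y⁻¹) < Real.log (1 + x⁻¹) :=
      Real.log_lt_log (by positivity) (by have := inv_strictAnti₀ hx hxy; linarith)
    refine inv_strictAnti₀ (div_pos (exp_sub_one_pos (hw y hy)) (hw y hy)) ?_
    exact exp_secant_lt (hw y hy).ne' (hw x hx).ne' hlog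
  have hx₀val : (1 - z) / z * Real.log (1 + ((1 - z) / z)⁻¹) = (1 + r)⁻¹ := by
    rw [hE _ hx₀, ← hzr]
    have : Real.log (1 + ((1 - z) / z)⁻¹) = -Real.log (1 - z) := by
      rw [← Real.log_inv]
      congr 1
      field_simp
      ring
    rw [this]
  have key := tendsto_ratio (x₀ := (1 - z) / z) (lam := (1 + r)⁻¹) (l := fun i => l i - 1)
    (a := fun i k => (Nat.stirlingFirst (m i - 1) k : ℝ) * ((m i - 1 : ℕ) : ℝ) ^ k)
    (P := fun i y => ∏ j ∈ Finset.range (m i - 1), (((m i - 1 : ℕ) : ℝ) * y + j))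
    (L := fun i => ((m i - 1 : ℕ) : ℝ))
    (c := fun i => ((m i - 1 : ℕ) : ℝ) * Real.log ((m i - 1 : ℕ) : ℝ))
    (Λ := fun y => (1 + y) * Real.log (1 + y) - y * Real.log y - 1)
    (h := fun y => y * Real.log (1 + y⁻¹)) hx₀
    (fun i => (logConcaveSeq_stirlingFirst (m i - 1)).mul (LogConcaveSeq.pow (by positivity)))
    (fun i y _ => hasSum_of_eq (hasSum_stirlingFirst (m i - 1) (((m i - 1 : ℕ) : ℝ) * y))
      (fun k => by rw [mul_pow]; ring) rfl)
    (by
      filter_upwards [hpos, hlm] with i hi hi2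
      have : (0 : ℝ) < ((m i - 1 : ℕ) : ℝ) := by exact_mod_cast (by omega : 0 < m i - 1)
      positivity)
    (tendsto_natCast_atTop_atTop.comp (tendsto_pred hm)) hdiv
    (by
      filter_upwards [eventually_nhdsWithin_of_eventually_nhds (eventually_gt_nhds hx₀)] with y hy
      refine ⟨?_, tendsto_growth_stirlingFirst (tendsto_pred hm) hy⟩
      have hd1 : HasDerivAt (fun y : ℝ => 1 + y) 1 y := (hasDerivAt_id y).const_add 1
      have h1y : 1 + y ≠ 0 := by positivity
      refine (((hd1.mul (hd1.log h1y)).sub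
        ((hasDerivAt_id y).mul (Real.hasDerivAt_log hy.ne'))).sub_const 1).congr_deriv ?_
      have e : 1 + y⁻¹ = (1 + y) / y := by field_simp; ring
      rw [e, Real.log_div h1y hy.ne']
      simp only [id]
      field_simp
      ring)
    (fun y hy hyz => by rw [← hx₀val]; exact hlt _ _ hy hyz)
    (fun y hyz => by rw [← hx₀val]; exact hlt _ _ hx₀ hyz)
  have hne : 1 + ((1 - z) / z)⁻¹ ≠ 0 := by positivity
  have hlim := ((tendsto_const_nhds (x := (1 : ℝ))).add key).inv₀ hne
  have hval : (1 + ((1 - z) / z)⁻¹)⁻¹ = 1 - z := by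
    field_simp
    ring
  rw [hval] at hlim
  refine hlim.congr' ?_
  filter_upwards [hlm, hpos, hl.eventually_gt_atTop 0] with i hi hp hi0
  obtain ⟨k, hk⟩ : ∃ k, l i = k + 1 := ⟨l i - 1, by omega⟩
  obtain ⟨n, hn⟩ : ∃ n, m i = n + 1 := ⟨m i - 1, by omega⟩
  rw [hk, hn, Nat.add_sub_cancel, Nat.add_sub_cancel] at hp hi
  rw [hk, hn, p₁_succ_succ, Nat.add_sub_cancel, Nat.add_sub_cancel, Nat.stirlingFirst_succ_succ]
  have hn0 : (0 : ℝ) < n := by exact_mod_cast (by omega : 0 < n)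
  have hD : (0 : ℝ) < (n : ℝ) * Nat.stirlingFirst n (k + 1) + Nat.stirlingFirst n k :=
    add_pos_of_nonneg_of_pos (by positivity) hp
  have e : 1 + (Nat.stirlingFirst n (k + 1) : ℝ) * (n : ℝ) ^ (k + 1) /
      ((Nat.stirlingFirst n k : ℝ) * (n : ℝ) ^ k) =
      ((n : ℝ) * Nat.stirlingFirst n (k + 1) + Nat.stirlingFirst n k) / Nat.stirlingFirst n k := by
    field_simp
    ring
  rw [e, inv_div, one_mul]
  push_cast
  rfl

theorem hasDerivAt_eulerianGrowth {y : ℝ} (hy : 0 < y) (hy1 : y ≠ 1) :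
    HasDerivAt (fun t => Real.log (t - 1) - Real.log (Real.log t))
      (uniformTilt (Real.log y) / y) y := by
  have h1 : y - 1 ≠ 0 := sub_ne_zero.2 hy1
  have h2 : Real.log y ≠ 0 := Real.log_ne_zero_of_pos_of_ne_one hy hy1
  refine ((((hasDerivAt_id y).sub_const 1).log h1).sub
    ((Real.hasDerivAt_log hy.ne').log h2)).congr_deriv ?_
  rw [uniformTilt_of_ne h2, Real.exp_log hy]
  simp only [id]
  field_simp

theorem tendsto_p₁_eulerian (hr : 0 < r) (hz : SaddleEuler r z)
    (hm : Tendsto m atTop atTop) (hl : Tendsto l atTop atTop)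
    (h : Tendsto (fun i => (m i : ℝ) / l i) atTop (𝓝 (1 + r))) :
    Tendsto (fun i => p₁ (fun n k => (n : ℝ) - (k : ℝ)) eulerian (m i) (l i)) atTop
      (𝓝 (1 - bernoulliQuotient z / (1 + r))) := by
  have hz' : uniformTilt z = (1 + r)⁻¹ := by rw [← one_div]; exact hz.symm
  have hdiv := tendsto_pred_div_pred (by linarith : 1 + r ≠ 0) hm hl h
  have hlm := eventually_lt_of_tendsto_div (inv_one_add_lt_one hr) (tendsto_pred hm) hdiv
  have hpos : ∀ᶠ i in atTop, (0 : ℝ) < eulerian (m i - 1) (l i - 1) := by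
    filter_upwards [hlm] with i hi
    have := eulerian_pos (m i - 2) (l i - 1) (by omega)
    rw [show m i - 2 + 1 = m i - 1 by omega] at this
    exact_mod_cast this
  -- The rate formula breaks down at `y = 1`, which is the saddle point itself when `z = 0`.
  have hne1 : ∀ᶠ y in 𝓝[≠] Real.exp z, y ≠ 1 := by
    by_cases h1 : Real.exp z = 1
    · rw [h1]; exact self_mem_nhdsWithin
    · exact eventually_nhdsWithin_of_eventually_nhds (eventually_ne_nhds h1)
  have key := tendsto_ratio (x₀ := Real.exp z) (lam := (1 + r)⁻¹) (l := fun i => l i - 1)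
    (a := fun i k => (eulerian (m i - 1) k : ℝ)) (P := fun i y => eulerianPoly (m i - 1) y)
    (L := fun i => ((m i - 1 : ℕ) : ℝ)) (c := fun i => Real.log (m i - 1).factorial)
    (Λ := fun y => Real.log (y - 1) - Real.log (Real.log y))
    (h := fun y => uniformTilt (Real.log y)) (Real.exp_pos z)
    (fun i => logConcaveSeq_eulerian (m i - 1)) (fun i y _ => hasSum_eulerian _ _) hpos
    (tendsto_natCast_atTop_atTop.comp (tendsto_pred hm)) hdiv
    (by
      filter_upwards [hne1, eventually_nhdsWithin_of_eventually_nhds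
        (eventually_gt_nhds (Real.exp_pos z))] with y hy1 hy
      exact ⟨hasDerivAt_eulerianGrowth hy hy1, tendsto_growth_eulerian (tendsto_pred hm) hy hy1⟩)
    (fun y hy hyz => by rw [← hz']; exact uniformTilt_strictMono ((Real.log_lt_iff_lt_exp hy).2 hyz))
    (fun y hyz => by
      rw [← hz']
      exact uniformTilt_strictMono ((Real.lt_log_iff_exp_lt ((Real.exp_pos z).trans hyz)).2 hyz))
  rw [one_sub_bernoulliQuotient_div hr hz, one_div]
  have hlam := inv_one_add_lt_one hr
  have hlam0 : 0 < (1 + r)⁻¹ := by positivity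
  -- The `2 * 0` is the limit of `2 / n`, since the weight is `(k + 2) / n` after scaling.
  have hne : 1 - (1 + r)⁻¹ + ((1 + r)⁻¹ + 2 * 0) * (Real.exp z)⁻¹ ≠ 0 :=
    ne_of_gt (add_pos (by linarith) (by positivity))
  have hnum := (tendsto_const_nhds (x := (1 : ℝ))).sub hdiv
  have hlim := hnum.div (hnum.add
    ((hdiv.add ((tendsto_natCast_inv (tendsto_pred hm)).const_mul 2)).mul key)) hne
  rw [mul_zero, add_zero] at hlim
  refine hlim.congr' ?_
  filter_upwards [hlm, hpos, hl.eventually_gt_atTop 0] with i hi hp hi0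
  obtain ⟨k, hk⟩ : ∃ k, l i = k + 1 := ⟨l i - 1, by omega⟩
  obtain ⟨n, hn⟩ : ∃ n, m i = n + 1 := ⟨m i - 1, by omega⟩
  simp only [Pi.div_apply]
  rw [hk, hn, Nat.add_sub_cancel, Nat.add_sub_cancel] at hp hi
  rw [hk, hn, p₁_succ_succ, Nat.add_sub_cancel, Nat.add_sub_cancel, cast_eulerian_succ_succ]
  have hn0 : (0 : ℝ) < n := by exact_mod_cast (by omega : 0 < n)
  have hkn : (0 : ℝ) < (n : ℝ) - k := by rw [sub_pos]; exact_mod_cast hi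
  have hD : 0 < ((n : ℝ) - k) * eulerian n k + ((k : ℝ) + 2) * eulerian n (k + 1) := by
    have : (0 : ℝ) ≤ eulerian n (k + 1) := by positivity
    positivity
  have e1 : 1 - (k : ℝ) / n = ((n : ℝ) - k) / n := by field_simp
  have e2 : 1 - (k : ℝ) / n + ((k : ℝ) / n + 2 * (n : ℝ)⁻¹) * ((eulerian n (k + 1) : ℝ) /
      eulerian n k) = (((n : ℝ) - k) * eulerian n k + ((k : ℝ) + 2) * eulerian n (k + 1)) /
      (n * eulerian n k) := by
    field_simp
  rw [e2, e1]
  push_cast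
  field_simp
  ring

end Limits

theorem bernoulliQuotient_div_mem {r z : ℝ} (hr : 0 < r) (h : SaddleEuler r z) :
    1 - bernoulliQuotient z / (1 + r) ∈ Set.Icc (0 : ℝ) 1 := by
  rw [one_sub_bernoulliQuotient_div hr h]
  have h1 := inv_one_add_lt_one hr
  rw [← one_div] at h1
  have h2 : 0 < 1 / (1 + r) * (Real.exp z)⁻¹ := by positivity
  exact ⟨div_nonneg (by linarith) (by linarith), (div_le_one (by linarith)).2 (by linarith)⟩

theorem exists_limitSlope {a : ℕ → ℕ → ℝ} {T : ℕ → ℕ → ℕ} {S : ℝ → ℝ → Prop} {f : ℝ → ℝ → ℝ}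
    (hS : ∀ r, 0 < r → ∃! z, S r z) (hf : ∀ r z, 0 < r → S r z → f r z ∈ Set.Icc (0 : ℝ) 1)
    (hlim : ∀ (r z : ℝ) (m l : ℕ → ℕ), 0 < r → S r z → Tendsto m atTop atTop →
      Tendsto l atTop atTop → Tendsto (fun i => (m i : ℝ) / l i) atTop (𝓝 (1 + r)) →
      Tendsto (fun i => p₁ a T (m i) (l i)) atTop (𝓝 (f r z))) :
    ∃ φ : Set.Ioi (0 : ℝ) → Set.Icc (0 : ℝ) 1, IsLimitSlope a T φ ∧
      ∀ r : Set.Ioi (0 : ℝ), (∃! z : ℝ, S r z) ∧ ∀ z : ℝ, S r z → (φ r : ℝ) = f r z := by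
  choose ζ hζ huniq using fun r : Set.Ioi (0 : ℝ) => hS r r.2
  exact ⟨fun r => ⟨f r (ζ r), hf r _ r.2 (hζ r)⟩,
    fun r m l hm hl h => hlim r _ m l r.2 (hζ r) hm hl h,
    fun r => ⟨hS r r.2, fun z hz => by rw [huniq r z hz]⟩⟩

end PascalTriangles

theorem mainTheorem2 :
    -- Pascal's triangle
    (∃ φ : Set.Ioi (0 : ℝ) → Set.Icc (0 : ℝ) 1,
      PascalTriangles.IsLimitSlope (fun _ _ => 1) Nat.choose φ ∧
      ∀ r : Set.Ioi (0 : ℝ), (φ r : ℝ) = 1 / (1 + (r : ℝ))) ∧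
    -- Stirling numbers of the second kind
    (∃ φ : Set.Ioi (0 : ℝ) → Set.Icc (0 : ℝ) 1,
      PascalTriangles.IsLimitSlope (fun _ _ => 1) Nat.stirlingSecond φ ∧
      ∀ r : Set.Ioi (0 : ℝ),
        (∃! z : ℝ, PascalTriangles.SaddleSecond r z) ∧
        ∀ z : ℝ, PascalTriangles.SaddleSecond r z → (φ r : ℝ) = Real.exp (-z)) ∧
    -- unsigned Stirling numbers of the first kind
    (∃ φ : Set.Ioi (0 : ℝ) → Set.Icc (0 : ℝ) 1,
      PascalTriangles.IsLimitSlope (fun _ _ => 1) Nat.stirlingFirst φ ∧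
      ∀ r : Set.Ioi (0 : ℝ),
        (∃! z : ℝ, PascalTriangles.SaddleFirst r z) ∧
        ∀ z : ℝ, PascalTriangles.SaddleFirst r z → (φ r : ℝ) = 1 - z) ∧
    -- Eulerian numbers
    (∃ φ : Set.Ioi (0 : ℝ) → Set.Icc (0 : ℝ) 1,
      PascalTriangles.IsLimitSlope (fun n k => (n : ℝ) - (k : ℝ)) PascalTriangles.eulerian φ ∧
      ∀ r : Set.Ioi (0 : ℝ),
        (∃! z : ℝ, PascalTriangles.SaddleEuler r z) ∧
        ∀ z : ℝ, PascalTriangles.SaddleEuler r z →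
          (φ r : ℝ) = 1 - PascalTriangles.bernoulliQuotient z / (1 + (r : ℝ))) := by

  refine ⟨?_, ?_, ?_, ?_⟩
  · refine ⟨fun r => ⟨1 / (1 + (r : ℝ)), ?_, ?_⟩,
      fun r m l hm hl h => PascalTriangles.tendsto_p₁_choose r.2 hm hl h, fun r => rfl⟩
    · have : (0 : ℝ) < r := r.2
      positivity
    · rw [one_div]; exact (PascalTriangles.inv_one_add_lt_one r.2).le
  · exact PascalTriangles.exists_limitSlope (f := fun _ z => Real.exp (-z))
      (fun r hr => PascalTriangles.existsUnique_saddleSecond hr)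
      (fun r z _ hz => ⟨(Real.exp_pos _).le, by linarith [PascalTriangles.one_sub_exp_neg_pos hz.1]⟩)
      (fun r z m l hr hz hm hl h => PascalTriangles.tendsto_p₁_stirlingSecond hr hz hm hl h)
  · exact PascalTriangles.exists_limitSlope (f := fun _ z => 1 - z)
      (fun r hr => PascalTriangles.existsUnique_saddleFirst hr)
      (fun r z _ hz => ⟨by linarith [hz.1.2], by linarith [hz.1.1]⟩)
      (fun r z m l hr hz hm hl h => PascalTriangles.tendsto_p₁_stirlingFirst hr hz hm hl h)
  · exact PascalTriangles.exists_limitSlope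
      (f := fun r z => 1 - PascalTriangles.bernoulliQuotient z / (1 + r))
      (fun r hr => PascalTriangles.existsUnique_saddleEuler hr)
      (fun r z hr hz => PascalTriangles.bernoulliQuotient_div_mem hr hz)
      (fun r z m l hr hz hm hl h => PascalTriangles.tendsto_p₁_eulerian hr hz hm hl h)
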